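/- **Setting.** Let $J>0$ and, for $N\ge 1$, let $\Lambda=[N]=\{1,\dots,N\}$ and $\mathcal S=\mathbb R^{\Lambda}$. Put $M[\phi]=\sum_x\phi_x$ and $N[\phi]=\|\phi\|^2=\sum_x\phi_x^2$ (here $\|\cdot\|$ is the Euclidean norm), and fix an orthogonal map $U:\mathcal S\to\mathbb R\times\mathbb R^{N-1}$ with $(U\phi)_1=N^{-1/2}M[\phi]$. For $I\subset\Lambda$ with $|I|=n$, let $P_I:\mathcal S\to\mathbb R^n$ be the projection onto the coordinates in $I$, taken in increasing order. For $\rho>0$ and $|m|<\sqrt\rho$ let $$\langle f\rangle_{\mathrm{MC}}^{m,\rho;N}=\frac1{|\mathbb S^{N-2}|}\int_{\mathbb S^{N-2}}d\Omega\,(f\circ U^{-1})\bigl(m\sqrt N,\sqrt{N(\rho-m^2)}\,\Omega\bigr).$$ For the mean-field spherical model with Hamiltonian $H[\phi]=-\frac{J}{2N}M[\phi]^2$ (that is, with external field $h=0$) and $\varepsilon\in(-J\rho/2,0]$, put $m_\pm=\pm\sqrt{-2\varepsilon/J}$; the fixed-energy microcanonical ensemble is $$\langle f\rangle_{\mathrm{MC}}^{\varepsilon,\rho;N}=\tfrac12\langle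 f\rangle_{\mathrm{MC}}^{m_+,\rho;N}+\tfrac12\langle f\rangle_{\mathrm{MC}}^{m_-,\rho;N},$$ which for $\varepsilon=0$ is $\langle f\rangle_{\mathrm{MC}}^{0,\rho;N}$ with $m=0$. For $\mu\in\mathbb R$, $\eta>0$, let $\langle\cdot\rangle_{\mathrm{GC}}^{\mu,\eta;N}$ be the probability measure on $\mathcal S$ with Lebesgue density proportional to $e^{-\mu M[\phi]-\eta N[\phi]}$, and, for $\bar\mu\ge0$, let $\langle\cdot\rangle_{\mathrm{AGC}}^{\bar\mu,\eta;N}$ be the one with density proportional to $e^{-\eta\|\phi\|^2}\cosh(\bar\mu M[\phi])$. **Theorem.** Let $h=0$, $\rho>0$ and $\varepsilon\in(-J\rho/2,0]$, and define $$\bar\mu=\frac{\sqrt{-2\varepsilon/J}}{\rho+2\varepsilon/J},\qquad \eta=\frac1{2(\rho+2\varepsilon/J)}.$$ Then $\langle\cdot\rangle_{\mathrm{AGC}}^{\bar\mu,\eta;N}=\frac12\langle\cdot\rangle_{\mathrm{GC}}^{\bar\mu,\eta;N}+\frac12\langle\cdot\rangle_{\mathrm{GC}}^{-\bar\mu,\eta;N}$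 for every $N$. Moreover, let $n\ge0$ and let $f:\mathbb R^n\to\mathbb R$ be either a bounded function that is $1$-Lipschitz with respect to the $2$-norm, or a moment $f(x)=\prod_{j=1}^n x_j^{k_j}$ with $k_j\in\mathbb N_0$. Then there are $C$ and $N_0$ (which may depend on $J,\rho,\varepsilon,n,f$) such that for all $N\ge N_0$ and all $I\subset\Lambda$ with $|I|=n$ the function $f\circ P_I$ is integrable with respect to both ensembles and $$\Bigl|\langle f\circ P_I\rangle_{\mathrm{MC}}^{\varepsilon,\rho;N}-\langle f\circ P_I\rangle_{\mathrm{AGC}}^{\bar\mu,\eta;N}\Bigr|\le C\,N^{-1/2}.$$ -/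

import Mathlib

open MeasureTheory

namespace MeanFieldSpherical

noncomputable section

/-- Field configurations `φ : Λ → ℝ` on a lattice `Λ = [N]` with `N` sites, with the `2`-norm. -/
abbrev Config (N : ℕ) : Type := EuclideanSpace ℝ (Fin N)

/-- The magnetization `M[φ] = ∑ₓ φ(x)`. -/
def magnetization {N : ℕ} (φ : Config N) : ℝ := ∑ x, φ x

/-- The particle number `N[φ] = ∑ₓ φ(x)²`. -/
def particleNumber {N : ℕ} (φ : Config N) : ℝ := ∑ x, φ x ^ 2

/-- The projection `P_I : ℝᴺ → ℝⁿ` onto the coordinates in `I`, `|I| = n`, listed in increasing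
order. -/
def proj {N n : ℕ} (I : Finset (Fin N)) (hI : I.card = n) (φ : Config N) :
    EuclideanSpace ℝ (Fin n) :=
  WithLp.toLp 2 fun j => φ (I.orderEmbOfFin hI j)

/-- There is an orthogonal map `U : ℝᴺ → ℝ × ℝᴺ⁻¹` whose first coordinate is
`φ ↦ N^{-1/2} ∑ₓ φ(x)`. -/
theorem exists_changeOfVar (N : ℕ) [NeZero N] :
    ∃ U : Config N ≃ₗᵢ[ℝ] WithLp 2 (ℝ × EuclideanSpace ℝ (Fin (N - 1))),
      ∀ φ : Config N, (U φ).fst = 1 / √(N : ℝ) * ∑ x, φ x := by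
  have hN : (0 : ℝ) < N := by exact_mod_cast Nat.pos_of_ne_zero (NeZero.ne N)
  set v : Config N := WithLp.toLp 2 fun _ => 1 / √(N : ℝ) with hv
  have hv1 : ‖v‖ = 1 := by
    rw [EuclideanSpace.norm_eq]
    simp [hv, hN.ne']
  have hcard : Module.finrank ℝ (Config N) = Fintype.card (Unit ⊕ Fin (N - 1)) := by
    have := Nat.pos_of_ne_zero (NeZero.ne N)
    simp
    omega
  have hon : Orthonormal ℝ (({Sum.inl ()} : Set (Unit ⊕ Fin (N - 1))).domRestrict
      fun _ => v) := by
    rw [orthonormal_iff_ite]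
    rintro ⟨i, hi⟩ ⟨j, hj⟩
    rw [Set.mem_singleton_iff] at hi hj
    subst hi
    subst hj
    simp [Set.domRestrict, hv1]
  obtain ⟨b, hb⟩ := hon.exists_orthonormalBasis_extension_of_card_eq hcard
  have hb0 : b (Sum.inl ()) = v := hb _ rfl
  let c : OrthonormalBasis (Unit ⊕ Fin (N - 1)) ℝ
      (WithLp 2 (ℝ × EuclideanSpace ℝ (Fin (N - 1)))) :=
    (OrthonormalBasis.singleton Unit ℝ).prod (EuclideanSpace.basisFun (Fin (N - 1)) ℝ)
  refine ⟨b.equiv c (Equiv.refl _), fun φ => ?_⟩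
  have h1 : (b.equiv c (Equiv.refl _) φ).fst
      = inner ℝ (c (Sum.inl ())) (b.equiv c (Equiv.refl _) φ) := by
    simp [c, WithLp.prod_inner_apply]
  have h2 : c (Sum.inl ()) = b.equiv c (Equiv.refl _) v := by
    rw [← hb0]
    simp
  rw [h1, h2, LinearIsometryEquiv.inner_map_map, PiLp.inner_apply]
  simp only [hv, one_div, RCLike.inner_apply, conj_trivial, Finset.mul_sum]
  exact Finset.sum_congr rfl fun _ _ => mul_comm _ _

/-- The fixed orthogonal change of variables `U : ℝᴺ → ℝ × ℝᴺ⁻¹`,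
`φ ↦ (z, ψ)` with `z = N^{-1/2} M[φ]`. -/
def changeOfVar (N : ℕ) [NeZero N] :
    Config N ≃ₗᵢ[ℝ] WithLp 2 (ℝ × EuclideanSpace ℝ (Fin (N - 1))) :=
  (exists_changeOfVar N).choose

/-- The unit sphere `𝕊ᴺ⁻²` of `ℝᴺ⁻¹`. -/
abbrev UnitSphere (N : ℕ) : Type := Metric.sphere (0 : EuclideanSpace ℝ (Fin (N - 1))) 1

/-- The uniform probability measure `dΩ / |𝕊ᴺ⁻²|` on `𝕊ᴺ⁻²` (for `N ≥ 2`). -/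
def sphereUniform (N : ℕ) : Measure (UnitSphere N) :=
  ((volume : Measure (EuclideanSpace ℝ (Fin (N - 1)))).toSphere Set.univ)⁻¹ •
    (volume : Measure (EuclideanSpace ℝ (Fin (N - 1)))).toSphere

/-- The auxiliary microcanonical ensemble with magnetization density `m` and particle density `ρ`:
`⟨f⟩ = |𝕊ᴺ⁻²|⁻¹ ∫ dΩ (f ∘ U⁻¹)(m √N, √(N (ρ - m²)) Ω)`. -/
def mcMag (N : ℕ) [NeZero N] (m ρ : ℝ) : Measure (Config N) :=
  (sphereUniform N).map fun Ω : UnitSphere N =>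
    (changeOfVar N).symm
      (WithLp.toLp 2 (m * √(N : ℝ), √((N : ℝ) * (ρ - m ^ 2)) • Ω.1))

/-- The specific auxiliary microcanonical partition function `(ρ - m²)^{(N-3)/2}`. -/
def zMag (N : ℕ) (m ρ : ℝ) : ℝ := (ρ - m ^ 2) ^ (((N : ℝ) - 3) / 2)

/-- `m₊ = -h/J + √(h²/J² - 2ε/J)`. -/
def mPlus (J h ε : ℝ) : ℝ := -(h / J) + √(h ^ 2 / J ^ 2 - 2 * ε / J)

/-- `m₋ = -h/J - √(h²/J² - 2ε/J)`. -/
def mMinus (J h ε : ℝ) : ℝ := -(h / J) - √(h ^ 2 / J ^ 2 - 2 * ε / J)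

open Classical in
/-- The microcanonical ensemble with energy density `ε` and particle density `ρ` of the model with
Hamiltonian `H[φ] = -J/(2N) M[φ]² - h M[φ]`. For values of `(ε, ρ)` at which the ensemble
is not defined this is the zero measure. -/
def mcEnergy (N : ℕ) [NeZero N] (J h ε ρ : ℝ) : Measure (Config N) :=
  if ε < h ^ 2 / (2 * J) ∧ mPlus J h ε ^ 2 < ρ ∧ mMinus J h ε ^ 2 < ρ then
    ENNReal.ofReal (zMag N (mPlus J h ε) ρ /
        (zMag N (mPlus J h ε) ρ + zMag N (mMinus J h ε) ρ)) • mcMag N (mPlus J h ε) ρ +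
      ENNReal.ofReal (zMag N (mMinus J h ε) ρ /
        (zMag N (mPlus J h ε) ρ + zMag N (mMinus J h ε) ρ)) • mcMag N (mMinus J h ε) ρ
  else if ε < h ^ 2 / (2 * J) ∧ min (mMinus J h ε ^ 2) (mPlus J h ε ^ 2) < ρ then
    if |mPlus J h ε| < |mMinus J h ε| then mcMag N (mPlus J h ε) ρ
    else mcMag N (mMinus J h ε) ρ
  else if ε = h ^ 2 / (2 * J) ∧ h ^ 2 / J ^ 2 < ρ then mcMag N (-(h / J)) ρ
  else 0

/-- The measure on `ℝᴺ` with Lebesgue density `w / ∫ w`. -/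
def normalizedDensity {N : ℕ} (w : Config N → ℝ) : Measure (Config N) :=
  (volume : Measure (Config N)).withDensity fun φ => ENNReal.ofReal (w φ / ∫ ψ, w ψ)

/-- The auxiliary grand canonical ensemble with magnetic potential `μ` and chemical potential `η`,
with density proportional to `exp(-μ M[φ] - η N[φ])`. -/
def gc (N : ℕ) (μ η : ℝ) : Measure (Config N) :=
  normalizedDensity fun φ => Real.exp (-μ * magnetization φ - η * particleNumber φ)

/-- The alternate auxiliary grand canonical ensemble, with density proportional to
`exp(-η ‖φ‖²) cosh(μ M[φ])`. -/
def agc (N : ℕ) (μ η : ℝ) : Measure (Config N) :=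
  normalizedDensity fun φ => Real.exp (-η * ‖φ‖ ^ 2) * Real.cosh (μ * magnetization φ)

/-- The local observables: bounded functions on `ℝⁿ` that are `1`-Lipschitz for the `2`-norm, and
finite moments `x ↦ ∏ⱼ xⱼ^{kⱼ}`. -/
def IsLocalObservable {n : ℕ} (f : EuclideanSpace ℝ (Fin n) → ℝ) : Prop :=
  ((∃ B : ℝ, ∀ x, |f x| ≤ B) ∧ LipschitzWith 1 f) ∨
    ∃ k : Fin n → ℕ, ∀ x, f x = ∏ j, x j ^ k j

end

end MeanFieldSpherical

namespace MeanFieldSpherical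

noncomputable section

open ProbabilityTheory
open scoped NNReal ENNReal

/-! Put `m = √(-2ε/J)` and `v = ρ - m²`. Since `μbar = m / v` and `η = 1 / (2v)`, completing the
square turns the grand canonical ensembles into products of Gaussians with mean `∓m` and variance
`v`, and the alternate ensemble into their even mixture. It remains to compare, for each sign, the
microcanonical ensemble at `±m` with independent Gaussian spins.

The comparison is a coupling. In the coordinates `U`, a Gaussian configuration is `(m √N + z, r ω)`
with `z`, `ω`, `r` independent, `z` Gaussian and `ω` uniform on the sphere
(`gaussianConfig_eq_map_polarConfig`). Keeping the same `ω` and replacing `z` by `0` and `r` by `√(N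
v)` gives exactly the microcanonical ensemble (`mcMag_eq_map_polarLaw`). The two configurations
differ at site `i` by `(√(N v) - r) τ_i - z / √N`, with `τ` the zero-magnetization configuration of
direction `ω`. The length `r` fluctuates by `O(1)` and `τ_i²` has mean `O(1/N)`, so the mean square
difference is `O(1/N)`, uniformly in `i` (`exists_sq_sphereConfig_sub_polarConfig_le`).

Local observables are locally Lipschitz with polynomially growing constant, and all moments of the
coordinates are bounded uniformly in `N`. A weighted AM-GM inequality
(`HasPolynomialGrowth.abs_sub_le`) with weight `√N` therefore yields the rate `N^{-1/2}`. -/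

/-! ### Gaussian form of the grand canonical ensembles. -/

lemma pi_gaussianReal_eq_withDensity {ι : Type*} [Fintype ι] (m : ℝ) {v : ℝ≥0} (hv : v ≠ 0) :
    (Measure.pi fun _ : ι => gaussianReal m v) =
      (volume : Measure (ι → ℝ)).withDensity
        fun x => ENNReal.ofReal (∏ i, gaussianPDFReal m v (x i)) := by
  refine Measure.pi_eq fun s hs => ?_
  have hint (i : ι) : Integrable (gaussianPDFReal m v) (volume.restrict (s i)) :=
    (integrable_gaussianPDFReal m v).restrict
  rw [withDensity_apply _ (MeasurableSet.univ_pi hs), volume_pi, Measure.restrict_pi_pi,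
    ← ofReal_integral_eq_lintegral_ofReal (Integrable.fintype_prod hint)
      (Filter.Eventually.of_forall fun x => Finset.prod_nonneg fun i _ =>
        gaussianPDFReal_nonneg m v (x i)),
    integral_fintype_prod_eq_prod (fun _ => gaussianPDFReal m v), ENNReal.ofReal_prod_of_nonneg]
  · simp only [gaussianReal_apply_eq_integral m hv]
  · exact fun i _ => integral_nonneg fun x => gaussianPDFReal_nonneg m v x

/-- The law of a configuration of `N` independent Gaussian spins with mean `m` and
variance `v`. -/
def gaussianConfig (N : ℕ) (m : ℝ) (v : ℝ≥0) : Measure (Config N) :=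
  (Measure.pi fun _ : Fin N => gaussianReal m v).map (WithLp.toLp 2)

instance (N : ℕ) (m : ℝ) (v : ℝ≥0) : IsProbabilityMeasure (gaussianConfig N m v) :=
  Measure.isProbabilityMeasure_map (MeasurableEquiv.toLp 2 _).measurable.aemeasurable

lemma gaussianConfig_eq_withDensity (N : ℕ) (m : ℝ) {v : ℝ≥0} (hv : v ≠ 0) :
    gaussianConfig N m v =
      volume.withDensity fun φ => ENNReal.ofReal (∏ i, gaussianPDFReal m v (φ i)) := by
  ext s hs
  have hp := PiLp.volume_preserving_toLp (Fin N)
  rw [gaussianConfig, Measure.map_apply hp.measurable hs, pi_gaussianReal_eq_withDensity m hv,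
    withDensity_apply _ (hp.measurable hs), withDensity_apply _ hs,
    ← hp.setLIntegral_comp_preimage_emb (MeasurableEquiv.toLp 2 _).measurableEmbedding]

lemma prod_gaussianPDFReal (N : ℕ) (m : ℝ) (v : ℝ≥0) (φ : Config N) :
    ∏ i, gaussianPDFReal m v (φ i) =
      (√(2 * Real.pi * v))⁻¹ ^ N * Real.exp (-(∑ i, (φ i - m) ^ 2) / (2 * v)) := by
  simp only [gaussianPDFReal, Finset.prod_mul_distrib, Finset.prod_const, Finset.card_univ,
    Fintype.card_fin, ← Real.exp_sum]
  rw [neg_div, Finset.sum_div, ← Finset.sum_neg_distrib]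
  simp only [neg_div]

lemma integrable_gaussianDensity (N : ℕ) (m : ℝ) (v : ℝ≥0) :
    Integrable (fun φ : Config N => ∏ i, gaussianPDFReal m v (φ i)) := by
  rw [← (PiLp.volume_preserving_toLp (Fin N)).integrable_comp_emb
    (MeasurableEquiv.toLp 2 _).measurableEmbedding]
  exact Integrable.fintype_prod (f := fun _ => gaussianPDFReal m v)
    fun _ => integrable_gaussianPDFReal m v

lemma integral_gaussianDensity (N : ℕ) (m : ℝ) {v : ℝ≥0} (hv : v ≠ 0) :
    ∫ φ : Config N, ∏ i, gaussianPDFReal m v (φ i) = 1 := by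
  rw [← (PiLp.volume_preserving_toLp (Fin N)).integral_comp
    (MeasurableEquiv.toLp 2 _).measurableEmbedding]
  simp only []
  rw [integral_fintype_prod_volume_eq_prod (fun _ => gaussianPDFReal m v)]
  simp [integral_gaussianPDFReal_eq_one m hv]

/-- The unnormalized density of the grand canonical ensemble is a multiple of a Gaussian
density. -/
lemma exists_gcDensity_eq (N : ℕ) (m : ℝ) {v : ℝ≥0} (hv : v ≠ 0) :
    ∃ c : ℝ, 0 < c ∧ (∀ φ : Config N,
      Real.exp (-(-(m / v)) * magnetization φ - 1 / (2 * v) * particleNumber φ) =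
        c * ∏ i, gaussianPDFReal m v (φ i)) ∧
      ∀ φ : Config N,
      Real.exp (-(m / v) * magnetization φ - 1 / (2 * v) * particleNumber φ) =
        c * ∏ i, gaussianPDFReal (-m) v (φ i) := by
  have hv' : (0 : ℝ) < v := NNReal.coe_pos.mpr (pos_iff_ne_zero.mpr hv)
  have hs : (0 : ℝ) < (√(2 * Real.pi * v)) ^ N := by positivity
  -- Completing the square.
  have key (m : ℝ) (φ : Config N) : -(∑ i, (φ i - m) ^ 2) / (2 * v) =
      -(N * m ^ 2 / (2 * v)) + (m / v * magnetization φ - 1 / (2 * v) * particleNumber φ) := by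
    have : ∑ i, (φ i - m) ^ 2 = particleNumber φ - 2 * m * magnetization φ + N * m ^ 2 := by
      simp only [sub_sq, Finset.sum_add_distrib, Finset.sum_sub_distrib, particleNumber,
        magnetization, Finset.mul_sum, Finset.sum_const, Finset.card_univ, Fintype.card_fin,
        nsmul_eq_mul]
      congr 2
      exact Finset.sum_congr rfl fun i _ => by ring
    rw [this]
    field_simp
    ring
  have hp (m : ℝ) (φ : Config N) :
      √(2 * Real.pi * v) ^ N * Real.exp (N * m ^ 2 / (2 * v)) * ∏ i, gaussianPDFReal m v (φ i) =
      Real.exp (m / v * magnetization φ - 1 / (2 * v) * particleNumber φ) := by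
    rw [prod_gaussianPDFReal, key m φ, Real.exp_add, Real.exp_neg, inv_pow]
    field_simp
  -- The constant is even in `m`, so one `c` serves both signs; this is what makes the mixture
  -- weights exactly `1/2`.
  refine ⟨√(2 * Real.pi * v) ^ N * Real.exp (N * m ^ 2 / (2 * v)), by positivity,
    fun φ => ?_, fun φ => ?_⟩
  · rw [hp, neg_neg]
  · rw [← neg_sq m, hp, neg_div]

lemma normalizedDensity_const_mul {N : ℕ} {c : ℝ} (hc : c ≠ 0) {w : Config N → ℝ}
    (hw : ∫ φ, w φ = 1) :
    normalizedDensity (fun φ => c * w φ) = volume.withDensity fun φ => ENNReal.ofReal (w φ) := by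
  unfold normalizedDensity
  simp only [integral_const_mul, hw, mul_one, mul_div_cancel_left₀ _ hc]

/-- The mean is `-m` because the weight carries `exp(-μ M)`. -/
lemma gc_eq_gaussianConfig (N : ℕ) (m : ℝ) {v : ℝ≥0} (hv : v ≠ 0) :
    gc N (m / v) (1 / (2 * v)) = gaussianConfig N (-m) v := by
  obtain ⟨c, hc, -, h⟩ := exists_gcDensity_eq N m hv
  rw [gc, funext h, normalizedDensity_const_mul hc.ne' (integral_gaussianDensity N (-m) hv),
    gaussianConfig_eq_withDensity N (-m) hv]

lemma agc_eq_gaussianConfig (N : ℕ) (m : ℝ) {v : ℝ≥0} (hv : v ≠ 0) :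
    agc N (m / v) (1 / (2 * v)) =
      ENNReal.ofReal (1 / 2) • gaussianConfig N m v +
        ENNReal.ofReal (1 / 2) • gaussianConfig N (-m) v := by
  obtain ⟨c, hc, h₁, h₂⟩ := exists_gcDensity_eq N m hv
  have hw (φ : Config N) : Real.exp (-(1 / (2 * (v : ℝ))) * ‖φ‖ ^ 2) *
      Real.cosh (m / v * magnetization φ) =
      c * (1 / 2 * ∏ i, gaussianPDFReal m v (φ i) + 1 / 2 * ∏ i, gaussianPDFReal (-m) v (φ i)) := by
    rw [mul_add, mul_left_comm, mul_left_comm c, ← h₁, ← h₂, Real.cosh_eq, neg_neg, sub_eq_add_neg,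
      sub_eq_add_neg, Real.exp_add, Real.exp_add, EuclideanSpace.real_norm_sq_eq, neg_mul, neg_mul,
      particleNumber]
    ring
  have h1 := integrable_gaussianDensity N m v
  have h2 := integrable_gaussianDensity N (-m) v
  rw [agc, funext hw, normalizedDensity_const_mul hc.ne', gaussianConfig_eq_withDensity N m hv,
    gaussianConfig_eq_withDensity N (-m) hv, ← withDensity_smul' _ _ ENNReal.ofReal_ne_top,
    ← withDensity_smul' _ _ ENNReal.ofReal_ne_top, ← withDensity_add_left]
  · congr 1
    ext φ
    have hn (m : ℝ) : 0 ≤ ∏ i, gaussianPDFReal m v (φ i) :=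
      Finset.prod_nonneg fun i _ => gaussianPDFReal_nonneg m v (φ i)
    simp only [Pi.add_apply, Pi.smul_apply, smul_eq_mul]
    rw [ENNReal.ofReal_add (mul_nonneg (by norm_num) (hn m)) (mul_nonneg (by norm_num) (hn (-m))),
      ENNReal.ofReal_mul (by norm_num), ENNReal.ofReal_mul (by norm_num)]
  · have : Measurable fun φ : Config N => ∏ i, gaussianPDFReal m v (φ i) :=
      Finset.measurable_prod _ fun i _ => (measurable_gaussianPDFReal m v).comp (by fun_prop)
    exact (this.ennreal_ofReal).const_smul _
  · rw [integral_add (h1.const_mul _) (h2.const_mul _), integral_const_mul, integral_const_mul,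
      integral_gaussianDensity N m hv, integral_gaussianDensity N (-m) hv]
    norm_num

/-! ### Polar coordinates and the transversal part of a configuration. -/

/-- Integration in polar coordinates. -/
lemma lintegral_polar {E : Type*} [NormedAddCommGroup E] [NormedSpace ℝ E] [MeasurableSpace E]
    [BorelSpace E] [FiniteDimensional ℝ E] [Nontrivial E] (μ : Measure E) [μ.IsAddHaarMeasure]
    {F : E → ℝ≥0∞} (hF : Measurable F) :
    ∫⁻ x, F x ∂μ = ∫⁻ ω, (∫⁻ r in Set.Ioi (0 : ℝ),
      ENNReal.ofReal (r ^ (Module.finrank ℝ E - 1)) * F (r • ω.1)) ∂μ.toSphere := by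
  have hs : MeasurableSet ({0}ᶜ : Set E) := (measurableSet_singleton _).compl
  have hmp : MeasurePreserving (homeomorphUnitSphereProd E).toMeasurableEquiv
      (μ.comap (↑)) (μ.toSphere.prod (Measure.volumeIoiPow (Module.finrank ℝ E - 1))) :=
    μ.measurePreserving_homeomorphUnitSphereProd
  have h1 : ∫⁻ x, F x ∂μ = ∫⁻ x : ({0}ᶜ : Set E), F x.1 ∂(μ.comap (↑)) := by
    rw [lintegral_subtype_comap hs, restrict_compl_singleton]
  have hcont : Measurable fun p : Metric.sphere (0 : E) 1 × Set.Ioi (0 : ℝ) =>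
      p.2.1 • p.1.1 := by fun_prop
  have hF' : Measurable fun x : ({0}ᶜ : Set E) => F x.1 := hF.comp measurable_subtype_coe
  rw [h1, ← hmp.symm.lintegral_comp hF']
  have h2 (p : Metric.sphere (0 : E) 1 × Set.Ioi (0 : ℝ)) :
      ((homeomorphUnitSphereProd E).toMeasurableEquiv.symm p).1 = p.2.1 • p.1.1 := rfl
  simp only [h2]
  rw [lintegral_prod (fun p : Metric.sphere (0 : E) 1 × Set.Ioi (0 : ℝ) => F (p.2.1 • p.1.1))
    (hF.comp hcont).aemeasurable]
  refine lintegral_congr fun ω => ?_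
  have hm : Measurable fun r : ℝ => F (r • ω.1) := hF.comp (by fun_prop)
  have hm' : Measurable fun r : Set.Ioi (0 : ℝ) => F (r.1 • ω.1) :=
    hm.comp measurable_subtype_coe
  rw [Measure.volumeIoiPow, lintegral_withDensity_eq_lintegral_mul _ (by fun_prop) hm',
    ← lintegral_subtype_comap measurableSet_Ioi]
  rfl

lemma changeOfVar_fst (N : ℕ) [NeZero N] (φ : Config N) :
    (changeOfVar N φ).fst = 1 / √(N : ℝ) * ∑ x, φ x :=
  (exists_changeOfVar N).choose_spec φ

/-- The first coordinate already exhausts the squared norm `N c²`, so Pythagoras leaves nothing for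
the second. This pins down `U` on constants although `U` is only known to exist. -/
lemma changeOfVar_const (N : ℕ) [NeZero N] (c : ℝ) :
    changeOfVar N (WithLp.toLp 2 fun _ => c) = WithLp.toLp 2 (c * √(N : ℝ), 0) := by
  have hN : (0 : ℝ) < N := by exact_mod_cast Nat.pos_of_ne_zero (NeZero.ne N)
  have hf : (changeOfVar N (WithLp.toLp 2 fun _ => c)).fst = c * √(N : ℝ) := by
    rw [changeOfVar_fst]
    simp only [Finset.sum_const, Finset.card_univ, Fintype.card_fin, nsmul_eq_mul]
    field_simp
    rw [Real.sq_sqrt hN.le]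
  have hn : ‖changeOfVar N (WithLp.toLp 2 fun _ => c)‖ ^ 2 = N * c ^ 2 := by
    rw [LinearIsometryEquiv.norm_map, EuclideanSpace.real_norm_sq_eq]
    simp
  rw [WithLp.prod_norm_sq_eq_of_L2, hf, Real.norm_eq_abs, sq_abs, mul_pow, Real.sq_sqrt hN.le,
    mul_comm, add_eq_left, sq_eq_zero_iff, norm_eq_zero] at hn
  apply WithLp.ofLp_injective 2
  exact Prod.ext hf hn

/-- The configuration with transversal part `y` and zero magnetization. -/
def transversal (N : ℕ) [NeZero N] (y : EuclideanSpace ℝ (Fin (N - 1))) : Config N :=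
  (changeOfVar N).symm (WithLp.toLp 2 (0, y))

lemma changeOfVar_symm_apply (N : ℕ) [NeZero N] (t : ℝ) (y : EuclideanSpace ℝ (Fin (N - 1)))
    (i : Fin N) :
    (changeOfVar N).symm (WithLp.toLp 2 (t, y)) i = t / √(N : ℝ) + transversal N y i := by
  have hN : (0 : ℝ) < N := by exact_mod_cast Nat.pos_of_ne_zero (NeZero.ne N)
  have h : WithLp.toLp 2 (t, y) = changeOfVar N (WithLp.toLp 2 fun _ => t / √(N : ℝ)) +
      WithLp.toLp 2 (0, y) := by
    rw [changeOfVar_const, div_mul_cancel₀ _ (by positivity), ← WithLp.toLp_add]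
    simp
  rw [h, map_add, LinearIsometryEquiv.symm_apply_apply]
  rfl

lemma sum_transversal (N : ℕ) [NeZero N] (y : EuclideanSpace ℝ (Fin (N - 1))) :
    ∑ i, transversal N y i = 0 := by
  have hN : (0 : ℝ) < N := by exact_mod_cast Nat.pos_of_ne_zero (NeZero.ne N)
  have h := changeOfVar_fst N (transversal N y)
  rw [transversal, LinearIsometryEquiv.apply_symm_apply] at h
  simpa [transversal, hN.ne'] using h.symm

lemma sum_sq_transversal (N : ℕ) [NeZero N] (y : EuclideanSpace ℝ (Fin (N - 1))) :
    ∑ i, transversal N y i ^ 2 = ‖y‖ ^ 2 := by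
  rw [← EuclideanSpace.real_norm_sq_eq, transversal, LinearIsometryEquiv.norm_map,
    WithLp.prod_norm_sq_eq_of_L2]
  simp

lemma transversal_smul (N : ℕ) [NeZero N] (r : ℝ) (y : EuclideanSpace ℝ (Fin (N - 1)))
    (i : Fin N) : transversal N (r • y) i = r * transversal N y i := by
  have : WithLp.toLp 2 ((0 : ℝ), r • y) = r • WithLp.toLp 2 ((0 : ℝ), y) := by
    apply WithLp.ofLp_injective 2
    exact Prod.ext (by simp) rfl
  rw [transversal, this, map_smul]
  rfl

lemma continuous_transversal (N : ℕ) [NeZero N] : Continuous (transversal N) :=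
  (changeOfVar N).symm.continuous.comp (by fun_prop)

lemma abs_transversal_le (N : ℕ) [NeZero N] (ω : UnitSphere N) (i : Fin N) :
    |transversal N ω.1 i| ≤ 1 := by
  have h := sum_sq_transversal N ω.1
  have h1 : ‖ω.1‖ = 1 := by simp
  rw [h1, one_pow] at h
  have := Finset.single_le_sum (f := fun i => transversal N ω.1 i ^ 2)
    (fun i _ => sq_nonneg _) (Finset.mem_univ i)
  rw [h] at this
  exact (sq_le_one_iff_abs_le_one _).mp this

/-- The cross term vanishes because transversal configurations have zero sum. Hence the Gaussian
exponent splits into a function of `z` and one of `‖y‖`. -/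
lemma sum_sq_changeOfVar_symm (N : ℕ) [NeZero N] (m z : ℝ)
    (y : EuclideanSpace ℝ (Fin (N - 1))) :
    ∑ i, ((changeOfVar N).symm (WithLp.toLp 2 (m * √(N : ℝ) + z, y)) i - m) ^ 2 =
      z ^ 2 + ‖y‖ ^ 2 := by
  have hN : (0 : ℝ) < N := by exact_mod_cast Nat.pos_of_ne_zero (NeZero.ne N)
  have hN' : (0 : ℝ) < √(N : ℝ) := Real.sqrt_pos.mpr hN
  have h (i : Fin N) :
      ((changeOfVar N).symm (WithLp.toLp 2 (m * √(N : ℝ) + z, y)) i - m) ^ 2 =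
        z ^ 2 / N + 2 * (z / √(N : ℝ)) * transversal N y i + transversal N y i ^ 2 := by
    rw [changeOfVar_symm_apply, add_div, mul_div_cancel_right₀ _ hN'.ne', add_assoc,
      add_sub_cancel_left, add_sq, div_pow, Real.sq_sqrt hN.le]
  rw [Finset.sum_congr rfl fun i _ => h i, Finset.sum_add_distrib, Finset.sum_add_distrib,
    ← Finset.mul_sum, sum_transversal, sum_sq_transversal]
  simp [mul_div_cancel₀ _ hN.ne']

/-! ### Independence of magnetization, direction and length under the Gaussian law. -/

/-- The weight `r ^ (d - 1) * exp (-r² / (2 v)) dr` on `(0, ∞)`. -/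
def radialWeight (d : ℕ) (v : ℝ≥0) : Measure ℝ :=
  (volume.restrict (Set.Ioi 0)).withDensity
    fun r => ENNReal.ofReal (r ^ (d - 1) * Real.exp (-r ^ 2 / (2 * v)))

instance (d : ℕ) (v : ℝ≥0) : SigmaFinite (radialWeight d v) := by
  unfold radialWeight
  infer_instance

/-- The law of the norm of a `d`-dimensional Gaussian vector with covariance `v`. -/
def radialLaw (d : ℕ) (v : ℝ≥0) : Measure ℝ :=
  (radialWeight d v Set.univ)⁻¹ • radialWeight d v

/-- The configuration with rescaled magnetization `m √N + z` and transversal part of direction `ω`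
and length `r`. -/
def polarConfig (N : ℕ) [NeZero N] (m : ℝ) (p : ℝ × UnitSphere N × ℝ) : Config N :=
  (changeOfVar N).symm (WithLp.toLp 2 (m * √(N : ℝ) + p.1, p.2.2 • p.2.1.1))

lemma continuous_polarConfig (N : ℕ) [NeZero N] (m : ℝ) : Continuous (polarConfig N m) :=
  (changeOfVar N).symm.continuous.comp (by fun_prop)

/-- `U` preserves volume, and translation invariance in the first coordinate recentres it at `m √N`.
-/
lemma lintegral_config (N : ℕ) [NeZero N] (m : ℝ) {F : Config N → ℝ≥0∞} (hF : Measurable F) :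
    ∫⁻ φ, F φ = ∫⁻ z : ℝ, ∫⁻ y : EuclideanSpace ℝ (Fin (N - 1)),
      F ((changeOfVar N).symm (WithLp.toLp 2 (m * √(N : ℝ) + z, y))) := by
  have h1 : MeasurePreserving (fun p : ℝ × EuclideanSpace ℝ (Fin (N - 1)) =>
      (changeOfVar N).symm (WithLp.toLp 2 p)) :=
    (changeOfVar N).symm.measurePreserving.comp (WithLp.volume_preserving_toLp _ _)
  rw [← h1.lintegral_comp hF, Measure.volume_eq_prod,
    lintegral_prod (fun p => F ((changeOfVar N).symm (WithLp.toLp 2 p)))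
      (hF.comp h1.measurable).aemeasurable]
  exact (lintegral_add_left_eq_self (fun z : ℝ => ∫⁻ y : EuclideanSpace ℝ (Fin (N - 1)),
      F ((changeOfVar N).symm (WithLp.toLp 2 (z, y)))) (m * √(N : ℝ))).symm

lemma gaussianConfig_eq_smul_map (N : ℕ) [NeZero N] (hN : 2 ≤ N) (m : ℝ) {v : ℝ≥0}
    (hv : v ≠ 0) :
    gaussianConfig N m v = ENNReal.ofReal ((√(2 * Real.pi * v))⁻¹ ^ (N - 1)) •
      ((gaussianReal 0 v).prod
        ((volume : Measure (EuclideanSpace ℝ (Fin (N - 1)))).toSphere.prod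
          (radialWeight (N - 1) v))).map (polarConfig N m) := by
  -- Polar coordinates need a nonzero transversal space, hence `2 ≤ N`.
  have : Nonempty (Fin (N - 1)) := ⟨⟨0, by omega⟩⟩
  have : Nontrivial (EuclideanSpace ℝ (Fin (N - 1))) := inferInstance
  ext s hs
  have hΦ := (continuous_polarConfig N m).measurable
  set A : ℝ≥0∞ := ENNReal.ofReal ((√(2 * Real.pi * v))⁻¹ ^ (N - 1)) with hA
  set g : Config N → ℝ≥0∞ := s.indicator 1
  have hgm : Measurable g := measurable_one.indicator hs
  have hpdf : Measurable fun φ : Config N => ENNReal.ofReal (∏ i, gaussianPDFReal m v (φ i)) :=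
    (Finset.measurable_prod _ fun i _ =>
      (measurable_gaussianPDFReal m v).comp (by fun_prop)).ennreal_ofReal
  have hU (z : ℝ) : Measurable fun y : EuclideanSpace ℝ (Fin (N - 1)) =>
      (changeOfVar N).symm (WithLp.toLp 2 (m * √(N : ℝ) + z, y)) :=
    ((changeOfVar N).symm.continuous.comp (by fun_prop)).measurable
  have hR : Measurable fun r : ℝ =>
      ENNReal.ofReal (r ^ (N - 1 - 1) * Real.exp (-r ^ 2 / (2 * v))) := by fun_prop
  -- Of the `N` normalizing factors, one completes the density of `z`; the other `N - 1` form `A`.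
  have hdens (z : ℝ) (y : EuclideanSpace ℝ (Fin (N - 1))) :
      ENNReal.ofReal (∏ i, gaussianPDFReal m v
        ((changeOfVar N).symm (WithLp.toLp 2 (m * √(N : ℝ) + z, y)) i)) =
      gaussianPDF 0 v z * (A * ENNReal.ofReal (Real.exp (-‖y‖ ^ 2 / (2 * v)))) := by
    rw [gaussianPDF, hA, ← ENNReal.ofReal_mul (by positivity),
      ← ENNReal.ofReal_mul (gaussianPDFReal_nonneg _ _ _), prod_gaussianPDFReal,
      sum_sq_changeOfVar_symm, gaussianPDFReal, sub_zero, neg_add, add_div, Real.exp_add]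
    congr 1
    have : (√(2 * Real.pi * v))⁻¹ ^ N =
        (√(2 * Real.pi * v))⁻¹ ^ (N - 1) * (√(2 * Real.pi * v))⁻¹ := by
      rw [← pow_succ, Nat.sub_add_cancel (by omega)]
    rw [this]
    ring
  have hinner : Measurable fun z : ℝ =>
      ∫⁻ ω : UnitSphere N, ∫⁻ r, g (polarConfig N m (z, ω, r)) ∂radialWeight (N - 1) v
        ∂(volume : Measure (EuclideanSpace ℝ (Fin (N - 1)))).toSphere := by
    have h : Measurable fun q : (ℝ × UnitSphere N) × ℝ =>
        g (polarConfig N m (q.1.1, q.1.2, q.2)) := hgm.comp (hΦ.comp (by fun_prop))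
    exact Measurable.lintegral_prod_right' (f := fun q : ℝ × UnitSphere N =>
      ∫⁻ r, g (polarConfig N m (q.1, q.2, r)) ∂radialWeight (N - 1) v)
      (Measurable.lintegral_prod_right' h)
  calc gaussianConfig N m v s
      = ∫⁻ φ, ENNReal.ofReal (∏ i, gaussianPDFReal m v (φ i)) * g φ := by
        rw [gaussianConfig_eq_withDensity N m hv, ← lintegral_indicator_one hs,
          lintegral_withDensity_eq_lintegral_mul _ hpdf hgm]
        rfl
    _ = ∫⁻ z, gaussianPDF 0 v z * (A * ∫⁻ y : EuclideanSpace ℝ (Fin (N - 1)),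
          ENNReal.ofReal (Real.exp (-‖y‖ ^ 2 / (2 * v))) *
            g ((changeOfVar N).symm (WithLp.toLp 2 (m * √(N : ℝ) + z, y)))) := by
        rw [lintegral_config N m (F := fun φ =>
          ENNReal.ofReal (∏ i, gaussianPDFReal m v (φ i)) * g φ) (hpdf.mul hgm)]
        refine lintegral_congr fun z => ?_
        have hm : Measurable fun y : EuclideanSpace ℝ (Fin (N - 1)) =>
          ENNReal.ofReal (Real.exp (-‖y‖ ^ 2 / (2 * v))) *
            g ((changeOfVar N).symm (WithLp.toLp 2 (m * √(N : ℝ) + z, y))) :=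
          Measurable.mul (by fun_prop) (hgm.comp (hU z))
        rw [← lintegral_const_mul _ hm, ← lintegral_const_mul _ (hm.const_mul _)]
        refine lintegral_congr fun y => ?_
        rw [hdens]
        ring
    _ = ∫⁻ z, gaussianPDF 0 v z * (A * ∫⁻ ω, ∫⁻ r, g (polarConfig N m (z, ω, r))
          ∂radialWeight (N - 1) v
          ∂(volume : Measure (EuclideanSpace ℝ (Fin (N - 1)))).toSphere) := by
        refine lintegral_congr fun z => ?_
        have hm : Measurable fun y : EuclideanSpace ℝ (Fin (N - 1)) =>
          ENNReal.ofReal (Real.exp (-‖y‖ ^ 2 / (2 * v))) *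
            g ((changeOfVar N).symm (WithLp.toLp 2 (m * √(N : ℝ) + z, y))) :=
          Measurable.mul (by fun_prop) (hgm.comp (hU z))
        rw [lintegral_polar volume hm]
        congr 2
        refine lintegral_congr fun ω => ?_
        have hm' : Measurable fun r : ℝ => g (polarConfig N m (z, ω, r)) :=
          hgm.comp (hΦ.comp (by fun_prop))
        rw [radialWeight, lintegral_withDensity_eq_lintegral_mul _ hR hm']
        refine setLIntegral_congr_fun measurableSet_Ioi fun r hr => ?_
        have hω : ‖r • ω.1‖ ^ 2 = r ^ 2 := by
          rw [norm_smul, mul_pow, norm_eq_of_mem_sphere, Real.norm_eq_abs, sq_abs]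
          simp
        simp only [Pi.mul_apply]
        rw [hω, finrank_euclideanSpace_fin, ENNReal.ofReal_mul (pow_nonneg (le_of_lt hr) _),
          ← mul_assoc]
        rfl
    _ = _ := by
        rw [Measure.smul_apply, smul_eq_mul, ← lintegral_indicator_one (hs),
          lintegral_map hgm hΦ,
          lintegral_prod (fun p => g (polarConfig N m p)) (hgm.comp hΦ).aemeasurable,
          gaussianReal_of_var_ne_zero 0 hv]
        have : ∀ z : ℝ, ∫⁻ q : UnitSphere N × ℝ, g (polarConfig N m (z, q))
            ∂(volume : Measure (EuclideanSpace ℝ (Fin (N - 1)))).toSphere.prod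
              (radialWeight (N - 1) v) =
            ∫⁻ ω, ∫⁻ r, g (polarConfig N m (z, ω, r)) ∂radialWeight (N - 1) v
              ∂(volume : Measure (EuclideanSpace ℝ (Fin (N - 1)))).toSphere := fun z =>
          lintegral_prod (fun q => g (polarConfig N m (z, q)))
            (hgm.comp (hΦ.comp (by fun_prop))).aemeasurable
        simp only [this]
        rw [lintegral_withDensity_eq_lintegral_mul _ (measurable_gaussianPDF 0 v) hinner,
          ← lintegral_const_mul _ ((measurable_gaussianPDF 0 v).mul hinner)]
        refine lintegral_congr fun z => ?_
        simp only [Pi.mul_apply]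
        ring

/-- Comparing total masses in `gaussianConfig_eq_smul_map` gives the normalization, with no need for
the area of the sphere or a Gamma integral. -/
lemma radialWeight_univ (N : ℕ) [NeZero N] (hN : 2 ≤ N) {v : ℝ≥0} (hv : v ≠ 0) :
    ENNReal.ofReal ((√(2 * Real.pi * v))⁻¹ ^ (N - 1)) *
      ((volume : Measure (EuclideanSpace ℝ (Fin (N - 1)))).toSphere Set.univ *
        radialWeight (N - 1) v Set.univ) = 1 := by
  have h := congrArg (fun μ => μ Set.univ) (gaussianConfig_eq_smul_map N hN 0 hv)
  simp only [measure_univ, Measure.smul_apply, smul_eq_mul] at h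
  rw [Measure.map_apply (continuous_polarConfig N 0).measurable MeasurableSet.univ,
    Set.preimage_univ, ← Set.univ_prod_univ, Measure.prod_prod, ← Set.univ_prod_univ,
    Measure.prod_prod, measure_univ, one_mul] at h
  exact h.symm

lemma isProbabilityMeasure_inv_smul {α : Type*} [MeasurableSpace α] {μ : Measure α}
    (h0 : μ Set.univ ≠ 0) (hT : μ Set.univ ≠ ∞) :
    IsProbabilityMeasure ((μ Set.univ)⁻¹ • μ) :=
  ⟨by rw [Measure.smul_apply, smul_eq_mul, ENNReal.inv_mul_cancel h0 hT]⟩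

lemma toSphere_univ_ne_zero {N : ℕ} (hN : 2 ≤ N) :
    (volume : Measure (EuclideanSpace ℝ (Fin (N - 1)))).toSphere Set.univ ≠ 0 := by
  have : Nonempty (Fin (N - 1)) := ⟨⟨0, by omega⟩⟩
  have : Nontrivial (EuclideanSpace ℝ (Fin (N - 1))) := inferInstance
  exact (Measure.measure_univ_ne_zero).mpr (Measure.toSphere_ne_zero _)

lemma isProbabilityMeasure_sphereUniform {N : ℕ} (hN : 2 ≤ N) :
    IsProbabilityMeasure (sphereUniform N) :=
  isProbabilityMeasure_inv_smul (toSphere_univ_ne_zero hN) (measure_ne_top _ _)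

lemma radialWeight_univ_ne {N : ℕ} [NeZero N] (hN : 2 ≤ N) {v : ℝ≥0} (hv : v ≠ 0) :
    radialWeight (N - 1) v Set.univ ≠ 0 ∧ radialWeight (N - 1) v Set.univ ≠ ∞ := by
  have h := radialWeight_univ N hN hv
  have hv' : (0 : ℝ) < v := NNReal.coe_pos.mpr (pos_iff_ne_zero.mpr hv)
  have hA : ENNReal.ofReal ((√(2 * Real.pi * v))⁻¹ ^ (N - 1)) ≠ 0 := by
    rw [Ne, ENNReal.ofReal_eq_zero, not_le]
    positivity
  refine ⟨fun h0 => by simp [h0] at h, fun hT => ?_⟩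
  rw [hT, ENNReal.mul_top (toSphere_univ_ne_zero hN), ENNReal.mul_top hA] at h
  exact ENNReal.top_ne_one h

lemma isProbabilityMeasure_radialLaw {N : ℕ} [NeZero N] (hN : 2 ≤ N) {v : ℝ≥0} (hv : v ≠ 0) :
    IsProbabilityMeasure (radialLaw (N - 1) v) :=
  isProbabilityMeasure_inv_smul (radialWeight_univ_ne hN hv).1 (radialWeight_univ_ne hN hv).2

/-- The joint law of the magnetization fluctuation, the direction and the length of the transversal
part of a Gaussian configuration. -/
def polarLaw (N : ℕ) (v : ℝ≥0) : Measure (ℝ × UnitSphere N × ℝ) :=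
  (gaussianReal 0 v).prod ((sphereUniform N).prod (radialLaw (N - 1) v))

lemma gaussianConfig_eq_map_polarConfig (N : ℕ) [NeZero N] (hN : 2 ≤ N) (m : ℝ) {v : ℝ≥0}
    (hv : v ≠ 0) :
    gaussianConfig N m v = (polarLaw N v).map (polarConfig N m) := by
  have h := radialWeight_univ N hN hv
  rw [gaussianConfig_eq_smul_map N hN m hv, polarLaw, sphereUniform, radialLaw,
    Measure.prod_smul_left, Measure.prod_smul_right, Measure.prod_smul_right,
    Measure.prod_smul_right, Measure.map_smul, Measure.map_smul, smul_smul,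
    ENNReal.eq_inv_of_mul_eq_one_left h,
    ENNReal.mul_inv (.inl (toSphere_univ_ne_zero hN)) (.inl (measure_ne_top _ _))]

/-- Only the direction is used, so this realizes the microcanonical ensemble on the probability
space of the Gaussian one: the coupling. -/
lemma mcMag_eq_map_polarLaw (N : ℕ) [NeZero N] (hN : 2 ≤ N) (m ρ : ℝ) {v : ℝ≥0} (hv : v ≠ 0) :
    mcMag N m ρ = (polarLaw N v).map fun p => (changeOfVar N).symm
      (WithLp.toLp 2 (m * √(N : ℝ), √((N : ℝ) * (ρ - m ^ 2)) • p.2.1.1)) := by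
  have := isProbabilityMeasure_sphereUniform hN
  have := isProbabilityMeasure_radialLaw hN hv
  have h : (polarLaw N v).map (fun p => p.2.1) = sphereUniform N := by
    have h1 := Measure.map_snd_prod (μ := gaussianReal 0 v)
      (ν := (sphereUniform N).prod (radialLaw (N - 1) v))
    have h2 := Measure.map_fst_prod (μ := sphereUniform N) (ν := radialLaw (N - 1) v)
    rw [measure_univ, one_smul] at h1 h2
    have h3 : (fun p : ℝ × UnitSphere N × ℝ => p.2.1) = Prod.fst ∘ Prod.snd := rfl
    rw [polarLaw, h3, ← Measure.map_map measurable_fst measurable_snd, h1, h2]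
  have hm : Measurable fun ω : UnitSphere N => (changeOfVar N).symm
      (WithLp.toLp 2 (m * √(N : ℝ), √((N : ℝ) * (ρ - m ^ 2)) • ω.1)) :=
    ((changeOfVar N).symm.continuous.comp (by fun_prop)).measurable
  rw [mcMag, ← h, Measure.map_map hm (by fun_prop)]
  rfl

/-! ### Observables of polynomial growth. -/

/-- Functions on `ℝⁿ` of polynomial growth that are locally Lipschitz with a constant of polynomial
growth. -/
def HasPolynomialGrowth {n : ℕ} (g : EuclideanSpace ℝ (Fin n) → ℝ) : Prop :=
  ∃ C : ℝ, ∃ K : ℕ, 0 ≤ C ∧ ∀ x y,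
    |g x - g y| ≤ C * (∑ j, |x j - y j|) * (1 + ∑ j, |x j| + ∑ j, |y j|) ^ K ∧
    |g x| ≤ C * (1 + ∑ j, |x j| + ∑ j, |y j|) ^ K

namespace HasPolynomialGrowth

variable {n : ℕ} {g h : EuclideanSpace ℝ (Fin n) → ℝ}

lemma mul (hg : HasPolynomialGrowth g) (hh : HasPolynomialGrowth h) :
    HasPolynomialGrowth fun x => g x * h x := by
  obtain ⟨C₁, K₁, hC₁, h₁⟩ := hg
  obtain ⟨C₂, K₂, hC₂, h₂⟩ := hh
  refine ⟨2 * C₁ * C₂, K₁ + K₂, by positivity, fun x y => ?_⟩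
  have hS : 0 ≤ 1 + ∑ j, |x j| + ∑ j, |y j| := by positivity
  -- The growth weight is symmetric in `x` and `y`, so it also controls `h y`.
  have hcomm : 1 + ∑ j, |y j| + ∑ j, |x j| = 1 + ∑ j, |x j| + ∑ j, |y j| := by ring
  have hhy := (h₂ y x).2
  rw [hcomm] at hhy
  set S := 1 + ∑ j, |x j| + ∑ j, |y j|
  set δ := ∑ j, |x j - y j|
  have hδ : 0 ≤ δ := by positivity
  constructor
  · calc |g x * h x - g y * h y| = |g x * (h x - h y) + (g x - g y) * h y| := by ring_nf
      _ ≤ |g x| * |h x - h y| + |g x - g y| * |h y| := by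
        rw [← abs_mul, ← abs_mul]
        exact abs_add_le _ _
      _ ≤ (C₁ * S ^ K₁) * (C₂ * δ * S ^ K₂) + (C₁ * δ * S ^ K₁) * (C₂ * S ^ K₂) := by
        gcongr
        exacts [(h₁ x y).2, (h₂ x y).1, (h₁ x y).1]
      _ = _ := by ring
  · calc |g x * h x| = |g x| * |h x| := abs_mul _ _
      _ ≤ (C₁ * S ^ K₁) * (C₂ * S ^ K₂) := by
        gcongr
        exacts [(h₁ x y).2, (h₂ x y).2]
      _ ≤ 2 * ((C₁ * S ^ K₁) * (C₂ * S ^ K₂)) := by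
        have : 0 ≤ (C₁ * S ^ K₁) * (C₂ * S ^ K₂) := by positivity
        linarith
      _ = _ := by ring

lemma one : HasPolynomialGrowth fun _ : EuclideanSpace ℝ (Fin n) => 1 :=
  ⟨1, 0, zero_le_one, fun x y => ⟨by simp; positivity, by simp⟩⟩

lemma coord (j : Fin n) : HasPolynomialGrowth fun x : EuclideanSpace ℝ (Fin n) => x j := by
  refine ⟨1, 1, zero_le_one, fun x y => ?_⟩
  have h1 : |x j - y j| ≤ ∑ j, |x j - y j| :=
    Finset.single_le_sum (f := fun j => |x j - y j|) (fun _ _ => abs_nonneg _) (Finset.mem_univ j)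
  have h2 : |x j| ≤ ∑ j, |x j| :=
    Finset.single_le_sum (f := fun j => |x j|) (fun _ _ => abs_nonneg _) (Finset.mem_univ j)
  have hx : 0 ≤ ∑ j, |x j| := by positivity
  have hy : 0 ≤ ∑ j, |y j| := by positivity
  simp only [one_mul, pow_one]
  refine ⟨h1.trans (le_mul_of_one_le_right (by positivity) (by linarith)), by linarith⟩

lemma pow (hg : HasPolynomialGrowth g) (k : ℕ) : HasPolynomialGrowth fun x => g x ^ k := by
  induction k with
  | zero => simpa using one
  | succ k ih => simpa only [pow_succ] using ih.mul hg

lemma prod {ι : Type*} (s : Finset ι) {g : ι → EuclideanSpace ℝ (Fin n) → ℝ}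
    (hg : ∀ i, HasPolynomialGrowth (g i)) : HasPolynomialGrowth fun x => ∏ i ∈ s, g i x := by
  classical
  induction s using Finset.induction_on with
  | empty => simpa using one
  | insert i s hi ih => simpa only [Finset.prod_insert hi] using (hg i).mul ih

/-- A bound by squares, with a free parameter `t`. -/
lemma abs_sub_le (hg : HasPolynomialGrowth g) :
    ∃ A : ℝ, ∃ q : ℕ, 0 ≤ A ∧ ∀ t : ℝ, 0 < t → ∀ x y, |g x - g y| ≤
      A * (t * ∑ j, (x j - y j) ^ 2 +
        t⁻¹ * (1 + ∑ j, x j ^ (2 * q) + ∑ j, y j ^ (2 * q))) := by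
  obtain ⟨C, K, hC, h⟩ := hg
  -- The exponent `p + 1 = 2 (K + 1)` dominates the `2 K` coming from the squared weight and is
  -- even, so absolute values disappear; hence `q = K + 1`.
  set p := 2 * K + 1 with hp
  set B : ℝ := 3 ^ p * (1 + (n : ℝ) ^ p) with hB
  have hn : (0 : ℝ) ≤ n := by positivity
  have hB0 : 0 ≤ B := by positivity
  refine ⟨C * (n + B), K + 1, by positivity, fun t ht x y => ?_⟩
  have heven : Even (2 * (K + 1)) := even_two_mul _
  have hpow (x : EuclideanSpace ℝ (Fin n)) :
      (∑ j, |x j|) ^ (p + 1) ≤ (n : ℝ) ^ p * ∑ j, x j ^ (2 * (K + 1)) := by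
    have := pow_sum_le_card_mul_sum_pow (s := Finset.univ) (f := fun j => |x j|)
      (fun _ _ => abs_nonneg _) p
    have hp' : p + 1 = 2 * (K + 1) := by omega
    simpa only [hp', heven.pow_abs, Finset.card_univ, Fintype.card_fin] using this
  have hxy := (h x y).1
  have ha : 0 ≤ ∑ j, |x j| := by positivity
  have hb : 0 ≤ ∑ j, |y j| := by positivity
  have hX : 0 ≤ ∑ j, x j ^ (2 * (K + 1)) := Finset.sum_nonneg fun _ _ => heven.pow_nonneg _
  have hY : 0 ≤ ∑ j, y j ^ (2 * (K + 1)) := Finset.sum_nonneg fun _ _ => heven.pow_nonneg _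
  set a := ∑ j, |x j|
  set b := ∑ j, |y j|
  set X := ∑ j, x j ^ (2 * (K + 1))
  set Y := ∑ j, y j ^ (2 * (K + 1))
  set D := ∑ j, (x j - y j) ^ 2 with hD
  have hD0 : 0 ≤ D := by positivity
  have hδ : (∑ j, |x j - y j|) ^ 2 ≤ n * D := by
    simpa [hD] using sq_sum_le_card_mul_sum_sq (s := Finset.univ) (f := fun j => |x j - y j|)
  set δ := ∑ j, |x j - y j|
  have hS : ((1 + a + b) ^ K) ^ 2 ≤ B * (1 + X + Y) := by
    have h3 := pow_sum_le_card_mul_sum_pow (s := Finset.univ) (f := ![1, a, b])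
      (fun i _ => by fin_cases i <;> simp [ha, hb]) p
    simp only [Fin.sum_univ_three, Finset.card_univ, Fintype.card_fin, Matrix.cons_val_zero,
      Matrix.cons_val_one, Matrix.cons_val, one_pow] at h3
    have hnp : (0 : ℝ) ≤ (n : ℝ) ^ p := by positivity
    calc ((1 + a + b) ^ K) ^ 2 = (1 + a + b) ^ (2 * K) := by rw [← pow_mul, mul_comm]
      _ ≤ (1 + a + b) ^ (p + 1) := pow_le_pow_right₀ (by linarith) (by omega)
      _ ≤ 3 ^ p * (1 + a ^ (p + 1) + b ^ (p + 1)) := by exact_mod_cast h3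
      _ ≤ 3 ^ p * (1 + (n : ℝ) ^ p * X + (n : ℝ) ^ p * Y) := by
        gcongr
        exacts [hpow x, hpow y]
      _ ≤ 3 ^ p * ((1 + (n : ℝ) ^ p) * (1 + X + Y)) := by
        gcongr
        nlinarith
      _ = _ := by rw [hB]; ring
  set T := (1 + a + b) ^ K
  -- Weighted AM-GM, separating the small increment `δ` from the growth factor `T`.
  have hamgm : δ * T ≤ t * δ ^ 2 + t⁻¹ * T ^ 2 := by
    have h1 : t * δ ^ 2 + t⁻¹ * T ^ 2 - 2 * (δ * T) = t⁻¹ * (t * δ - T) ^ 2 := by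
      field_simp
      ring
    have h2 : 0 ≤ t⁻¹ * (t * δ - T) ^ 2 := by positivity
    have h3 : 0 ≤ δ * T := by positivity
    linarith
  calc |g x - g y| ≤ C * (δ * T) := by rw [← mul_assoc]; exact hxy
    _ ≤ C * (t * δ ^ 2 + t⁻¹ * T ^ 2) := by gcongr
    _ ≤ C * (t * (n * D) + t⁻¹ * (B * (1 + X + Y))) := by gcongr
    _ ≤ C * ((n + B) * (t * D) + (n + B) * (t⁻¹ * (1 + X + Y))) := by
      have h1 : 0 ≤ B * (t * D) := by positivity
      have h2 : 0 ≤ n * (t⁻¹ * (1 + X + Y)) := by positivity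
      gcongr ?_ * ?_
      linarith
    _ = _ := by ring

end HasPolynomialGrowth

lemma norm_le_sum_abs {n : ℕ} (x : EuclideanSpace ℝ (Fin n)) : ‖x‖ ≤ ∑ j, |x j| := by
  rw [EuclideanSpace.norm_eq]
  refine Real.sqrt_le_iff.mpr ⟨by positivity, ?_⟩
  exact Finset.sum_sq_le_sq_sum_of_nonneg fun _ _ => norm_nonneg _

lemma IsLocalObservable.hasPolynomialGrowth {n : ℕ} {f : EuclideanSpace ℝ (Fin n) → ℝ}
    (hf : IsLocalObservable f) : HasPolynomialGrowth f := by
  obtain ⟨⟨B, hB⟩, hL⟩ | ⟨k, hk⟩ := hf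
  · refine ⟨max B 1, 0, by positivity, fun x y => ⟨?_, ?_⟩⟩
    · have h1 := hL.dist_le_mul x y
      rw [Real.dist_eq, dist_eq_norm, NNReal.coe_one, one_mul] at h1
      have h2 := norm_le_sum_abs (x - y)
      simp only [PiLp.sub_apply] at h2
      rw [pow_zero, mul_one]
      exact (h1.trans h2).trans (le_mul_of_one_le_left (by positivity) (le_max_right _ _))
    · simpa using Or.inl (hB x)
  · rw [funext hk]
    exact HasPolynomialGrowth.prod _ fun j => (HasPolynomialGrowth.coord j).pow (k j)

lemma IsLocalObservable.continuous {n : ℕ} {f : EuclideanSpace ℝ (Fin n) → ℝ}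
    (hf : IsLocalObservable f) : Continuous f := by
  obtain ⟨-, hL⟩ | ⟨k, hk⟩ := hf
  · exact hL.continuous
  · rw [funext hk]
    fun_prop

/-! ### Moments and concentration of the radial law. -/

/-- The unnormalized even moments of the radial weight. -/
def radialMoment (d : ℕ) (v : ℝ≥0) (k : ℕ) : ℝ :=
  ∫ r in Set.Ioi (0 : ℝ), r ^ (d - 1) * Real.exp (-r ^ 2 / (2 * v)) * r ^ (2 * k)

lemma radialIntegrand_eq {d : ℕ} (hd : 1 ≤ d) (v : ℝ≥0) (k : ℕ) (r : ℝ) :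
    r ^ (d - 1) * Real.exp (-r ^ 2 / (2 * v)) * r ^ (2 * k) =
      r ^ ((d : ℝ) - 1 + 2 * k) * Real.exp (-(1 / (2 * v)) * r ^ 2) := by
  have h : (d : ℝ) - 1 + 2 * k = ((d - 1 + 2 * k : ℕ) : ℝ) := by
    push_cast [Nat.cast_sub hd]
    ring
  rw [h, Real.rpow_natCast, pow_add]
  ring_nf

/-- The moments are Gamma integrals; the recursion is `Γ(s + 1) = s Γ(s)` at `s = d/2 + k`. -/
lemma radialMoment_succ {d : ℕ} (hd : 1 ≤ d) {v : ℝ≥0} (hv : v ≠ 0) (k : ℕ) :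
    radialMoment d v (k + 1) = (d + 2 * k) * v * radialMoment d v k := by
  have hv' : (0 : ℝ) < v := NNReal.coe_pos.mpr (pos_iff_ne_zero.mpr hv)
  have hd' : (1 : ℝ) ≤ d := by exact_mod_cast hd
  have hk : (0 : ℝ) ≤ k := by positivity
  have h (k : ℕ) : radialMoment d v k =
      (1 / (2 * (v : ℝ))) ^ (-((d : ℝ) / 2 + k)) * (1 / 2) * Real.Gamma ((d : ℝ) / 2 + k) := by
    have hk : (0 : ℝ) ≤ k := by positivity
    have := integral_rpow_mul_exp_neg_mul_rpow (p := 2) (q := (d : ℝ) - 1 + 2 * k)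
      (b := 1 / (2 * (v : ℝ))) (by norm_num) (by linarith) (by positivity)
    simp only [Real.rpow_two] at this
    simp only [radialMoment, radialIntegrand_eq hd]
    rw [this]
    congr 2
    · congr 1
      ring
    · ring
  rw [h, h]
  have hpos : 0 < (d : ℝ) / 2 + k := by linarith
  push_cast
  rw [← add_assoc, Real.Gamma_add_one hpos.ne', neg_add, Real.rpow_add (by positivity),
    Real.rpow_neg_one]
  field_simp

lemma integrable_radialIntegrand {d : ℕ} (hd : 1 ≤ d) {v : ℝ≥0} (hv : v ≠ 0) (k : ℕ) :
    Integrable fun r : ℝ => r ^ (d - 1) * Real.exp (-r ^ 2 / (2 * v)) * r ^ (2 * k) := by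
  have hv' : (0 : ℝ) < v := NNReal.coe_pos.mpr (pos_iff_ne_zero.mpr hv)
  have hd' : (1 : ℝ) ≤ d := by exact_mod_cast hd
  have hk : (0 : ℝ) ≤ k := by positivity
  simp only [radialIntegrand_eq hd]
  exact integrable_rpow_mul_exp_neg_mul_sq (by positivity) (by linarith)

lemma integrable_pow_radialLaw {d : ℕ} (hd : 1 ≤ d) {v : ℝ≥0} (hv : v ≠ 0)
    [IsProbabilityMeasure (radialLaw d v)] (k : ℕ) :
    Integrable (fun r => r ^ (2 * k)) (radialLaw d v) := by
  have hne : radialWeight d v Set.univ ≠ 0 := by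
    intro h0
    have h : radialLaw d v Set.univ = 1 := measure_univ
    rw [radialLaw, Measure.smul_apply, h0] at h
    simp at h
  refine Integrable.smul_measure ?_ (ENNReal.inv_ne_top.mpr hne)
  rw [radialWeight, integrable_withDensity_iff_integrable_smul' (by fun_prop) (by simp)]
  refine (integrable_radialIntegrand hd hv k).restrict.congr ?_
  filter_upwards [ae_restrict_mem measurableSet_Ioi] with r hr
  have hr' : (0 : ℝ) < r := hr
  rw [ENNReal.toReal_ofReal (by positivity), smul_eq_mul]

lemma integral_pow_radialLaw (d : ℕ) (v : ℝ≥0) (k : ℕ) :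
    ∫ r, r ^ (2 * k) ∂radialLaw d v =
      ((radialWeight d v Set.univ)⁻¹).toReal * radialMoment d v k := by
  rw [radialLaw, integral_smul_measure, radialWeight,
    integral_withDensity_eq_integral_toReal_smul (by fun_prop) (by simp), smul_eq_mul, radialMoment]
  congr 1
  refine setIntegral_congr_fun measurableSet_Ioi fun r hr => ?_
  have hr' : (0 : ℝ) < r := hr
  rw [ENNReal.toReal_ofReal (by positivity), smul_eq_mul]

lemma integral_pow_succ_radialLaw {d : ℕ} (hd : 1 ≤ d) {v : ℝ≥0} (hv : v ≠ 0) (k : ℕ) :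
    ∫ r, r ^ (2 * (k + 1)) ∂radialLaw d v =
      (d + 2 * k) * v * ∫ r, r ^ (2 * k) ∂radialLaw d v := by
  rw [integral_pow_radialLaw, integral_pow_radialLaw, radialMoment_succ hd hv]
  ring

lemma integral_sq_radialLaw {d : ℕ} (hd : 1 ≤ d) {v : ℝ≥0} (hv : v ≠ 0)
    [IsProbabilityMeasure (radialLaw d v)] : ∫ r, r ^ 2 ∂radialLaw d v = d * v := by
  simpa using integral_pow_succ_radialLaw hd hv 0

lemma integral_pow_four_radialLaw {d : ℕ} (hd : 1 ≤ d) {v : ℝ≥0} (hv : v ≠ 0)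
    [IsProbabilityMeasure (radialLaw d v)] :
    ∫ r, r ^ 4 ∂radialLaw d v = (d + 2) * v * (d * v) := by
  simpa [integral_sq_radialLaw hd hv] using integral_pow_succ_radialLaw hd hv 1

lemma pow_le_integral_pow_radialLaw {d : ℕ} (hd : 1 ≤ d) {v : ℝ≥0} (hv : v ≠ 0)
    [IsProbabilityMeasure (radialLaw d v)] (k : ℕ) :
    ((d : ℝ) * v) ^ k ≤ ∫ r, r ^ (2 * k) ∂radialLaw d v := by
  induction k with
  | zero => simp
  | succ k ih =>
    rw [integral_pow_succ_radialLaw hd hv, pow_succ']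
    gcongr
    have : (0 : ℝ) ≤ 2 * k := by positivity
    linarith

lemma radialLaw_ae_pos (d : ℕ) (v : ℝ≥0) : ∀ᵐ r ∂radialLaw d v, 0 < r := by
  refine Measure.ae_smul_measure ?_ _
  refine (withDensity_absolutelyContinuous _ _).ae_le ?_
  exact ae_restrict_mem measurableSet_Ioi

lemma integrable_sq_sub_radialLaw {d : ℕ} (hd : 1 ≤ d) {v : ℝ≥0} (hv : v ≠ 0)
    [IsProbabilityMeasure (radialLaw d v)] (s : ℝ) :
    Integrable (fun r => (s - r) ^ 2) (radialLaw d v) := by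
  have h2 : Integrable (fun r : ℝ => r ^ 2) (radialLaw d v) := by
    simpa using integrable_pow_radialLaw hd hv 1
  refine Integrable.mono' (((integrable_const (s ^ 2)).add h2).const_mul 2)
    (by fun_prop) (Filter.Eventually.of_forall fun r => ?_)
  rw [Real.norm_of_nonneg (sq_nonneg _)]
  simp only [Pi.add_apply]
  nlinarith [sq_nonneg (s + r)]

/-- The length of a Gaussian vector concentrates at the square root of the dimension. -/
lemma integral_sq_sub_radialLaw_le {d : ℕ} (hd : 1 ≤ d) {v : ℝ≥0} (hv : v ≠ 0)
    [IsProbabilityMeasure (radialLaw d v)] :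
    ∫ r, (√(((d : ℝ) + 1) * v) - r) ^ 2 ∂radialLaw d v ≤ 2 * v := by
  have hv' : (0 : ℝ) < v := NNReal.coe_pos.mpr (pos_iff_ne_zero.mpr hv)
  have hd' : (1 : ℝ) ≤ d := by exact_mod_cast hd
  -- For `d = N - 1` this is `N v`, the squared microcanonical radius, rather than the mean `d v` of
  -- `r²`.
  set a : ℝ := ((d : ℝ) + 1) * v with ha
  have ha0 : 0 < a := by positivity
  have hs : √a ^ 2 = a := Real.sq_sqrt ha0.le
  have hs0 : 0 < √a := Real.sqrt_pos.mpr ha0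
  have h2 : Integrable (fun r : ℝ => r ^ 2) (radialLaw d v) := by
    simpa using integrable_pow_radialLaw hd hv 1
  have h4 : Integrable (fun r : ℝ => r ^ 4) (radialLaw d v) := by
    simpa using integrable_pow_radialLaw hd hv 2
  have hint : Integrable (fun r : ℝ => a⁻¹ * (a ^ 2 - 2 * a * r ^ 2 + r ^ 4)) (radialLaw d v) :=
    (((integrable_const (a ^ 2)).sub (h2.const_mul (2 * a))).add h4).const_mul a⁻¹
  calc ∫ r, (√a - r) ^ 2 ∂radialLaw d v
      ≤ ∫ r, a⁻¹ * (a ^ 2 - 2 * a * r ^ 2 + r ^ 4) ∂radialLaw d v := by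
        refine integral_mono_ae (integrable_sq_sub_radialLaw hd hv _) hint ?_
        filter_upwards [radialLaw_ae_pos d v] with r hr
        -- Since `r > 0`, `(√a + r)² ≥ a`, so `(√a - r)² ≤ (a - r²)² / a`: second and fourth moments
        -- suffice.
        rw [inv_mul_eq_div, le_div_iff₀ ha0]
        have h1 : a ^ 2 - 2 * a * r ^ 2 + r ^ 4 = (√a - r) ^ 2 * (√a + r) ^ 2 := by
          calc a ^ 2 - 2 * a * r ^ 2 + r ^ 4 = (a - r ^ 2) ^ 2 := by ring
            _ = (√a ^ 2 - r ^ 2) ^ 2 := by rw [hs]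
            _ = _ := by ring
        rw [h1]
        gcongr
        rw [add_sq, hs]
        have := mul_pos hs0 hr
        nlinarith [sq_nonneg r]
    _ = a⁻¹ * (a ^ 2 - 2 * a * (d * v) + (d + 2) * v * (d * v)) := by
        have h12 : Integrable (fun r : ℝ => a ^ 2 - 2 * a * r ^ 2) (radialLaw d v) :=
          (integrable_const (a ^ 2)).sub (h2.const_mul (2 * a))
        rw [integral_const_mul, integral_add h12 h4, integral_sub (integrable_const _) (h2.const_mul _), integral_const_mul,
          integral_sq_radialLaw hd hv, integral_pow_four_radialLaw hd hv]
        simp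
    _ ≤ 2 * v := by
        -- The expression equals `v (2d + 1) / (d + 1)`.
        rw [inv_mul_eq_div, div_le_iff₀ ha0, ha]
        have : 0 < (v : ℝ) * v := by positivity
        nlinarith

/-! ### Coordinates of the two coupled configurations. -/

lemma integrable_pow_gaussianReal (m : ℝ) (v : ℝ≥0) (k : ℕ) :
    Integrable (fun x => x ^ (2 * k)) (gaussianReal m v) := by
  have h := (memLp_id_gaussianReal' (μ := m) (v := v) ((2 * k : ℕ) : ℝ≥0∞)
    (ENNReal.natCast_ne_top _)).integrable_norm_pow'
  simpa only [id, Real.norm_eq_abs, (even_two_mul k).pow_abs] using h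

lemma gaussianConfig_map_eval (N : ℕ) (m : ℝ) (v : ℝ≥0) (i : Fin N) :
    (gaussianConfig N m v).map (fun φ => φ i) = gaussianReal m v := by
  rw [gaussianConfig, Measure.map_map (by fun_prop)
    (PiLp.volume_preserving_toLp (Fin N)).measurable]
  exact (measurePreserving_eval (fun _ : Fin N => gaussianReal m v) i).map_eq

/-- The microcanonical configuration with magnetization density `m` and transversal part of
length `s`, in the direction of a point of `polarLaw`. -/
def sphereConfig (N : ℕ) [NeZero N] (m s : ℝ) (p : ℝ × UnitSphere N × ℝ) : Config N :=
  (changeOfVar N).symm (WithLp.toLp 2 (m * √(N : ℝ), s • p.2.1.1))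

lemma continuous_sphereConfig (N : ℕ) [NeZero N] (m s : ℝ) : Continuous (sphereConfig N m s) :=
  (changeOfVar N).symm.continuous.comp (by fun_prop)

lemma sqrt_natCast_pos (N : ℕ) [NeZero N] : 0 < √(N : ℝ) :=
  Real.sqrt_pos.mpr (by exact_mod_cast Nat.pos_of_ne_zero (NeZero.ne N))

lemma sphereConfig_apply (N : ℕ) [NeZero N] (m s : ℝ) (p : ℝ × UnitSphere N × ℝ) (i : Fin N) :
    sphereConfig N m s p i = m + s * transversal N p.2.1.1 i := by
  rw [sphereConfig, changeOfVar_symm_apply, transversal_smul,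
    mul_div_cancel_right₀ _ (sqrt_natCast_pos N).ne']

lemma polarConfig_apply (N : ℕ) [NeZero N] (m : ℝ) (p : ℝ × UnitSphere N × ℝ) (i : Fin N) :
    polarConfig N m p i = m + p.1 / √(N : ℝ) + p.2.2 * transversal N p.2.1.1 i := by
  rw [polarConfig, changeOfVar_symm_apply, transversal_smul, add_div,
    mul_div_cancel_right₀ _ (sqrt_natCast_pos N).ne']

section Moments

variable {N : ℕ} [NeZero N] {v : ℝ≥0}

lemma isProbabilityMeasure_polarLaw (hN : 2 ≤ N) (hv : v ≠ 0) :
    IsProbabilityMeasure (polarLaw N v) := by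
  have := isProbabilityMeasure_sphereUniform hN
  have := isProbabilityMeasure_radialLaw hN hv
  unfold polarLaw
  infer_instance

lemma integrable_transversal_pow (hN : 2 ≤ N) (i : Fin N) (k : ℕ) :
    Integrable (fun ω : UnitSphere N => transversal N ω.1 i ^ k) (sphereUniform N) := by
  have := isProbabilityMeasure_sphereUniform hN
  have hc : Continuous fun ω : UnitSphere N => transversal N ω.1 i ^ k :=
    (((EuclideanSpace.proj i).continuous.comp (continuous_transversal N)).comp
      continuous_subtype_val).pow k
  refine Integrable.of_bound hc.measurable.aestronglyMeasurable 1
    (Filter.Eventually.of_forall fun ω => ?_)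
  rw [norm_pow, Real.norm_eq_abs]
  exact pow_le_one₀ (abs_nonneg _) (abs_transversal_le N ω i)

lemma integrable_fst_polarLaw (hN : 2 ≤ N) (hv : v ≠ 0) {a : ℝ → ℝ}
    (ha : Integrable a (gaussianReal 0 v)) : Integrable (fun p => a p.1) (polarLaw N v) := by
  have := isProbabilityMeasure_sphereUniform hN
  have := isProbabilityMeasure_radialLaw hN hv
  exact ha.comp_fst _

lemma integral_fst_polarLaw (hN : 2 ≤ N) (hv : v ≠ 0) (a : ℝ → ℝ) :
    ∫ p, a p.1 ∂polarLaw N v = ∫ z, a z ∂gaussianReal 0 v := by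
  have := isProbabilityMeasure_sphereUniform hN
  have := isProbabilityMeasure_radialLaw hN hv
  simpa [polarLaw] using integral_fun_fst (μ := gaussianReal 0 v)
    (ν := (sphereUniform N).prod (radialLaw (N - 1) v)) a

lemma integrable_snd_polarLaw (hN : 2 ≤ N) (hv : v ≠ 0) {b : UnitSphere N → ℝ} {c : ℝ → ℝ}
    (hb : Integrable b (sphereUniform N)) (hc : Integrable c (radialLaw (N - 1) v)) :
    Integrable (fun p => c p.2.2 * b p.2.1) (polarLaw N v) := by
  have := isProbabilityMeasure_sphereUniform hN
  have := isProbabilityMeasure_radialLaw hN hv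
  simp only [mul_comm (c _)]
  exact (hb.mul_prod hc).comp_snd _

lemma integral_snd_polarLaw (hN : 2 ≤ N) (hv : v ≠ 0) (b : UnitSphere N → ℝ) (c : ℝ → ℝ) :
    ∫ p, c p.2.2 * b p.2.1 ∂polarLaw N v =
      (∫ r, c r ∂radialLaw (N - 1) v) * ∫ ω, b ω ∂sphereUniform N := by
  have := isProbabilityMeasure_sphereUniform hN
  have := isProbabilityMeasure_radialLaw hN hv
  simp only [mul_comm (c _)]
  rw [mul_comm (∫ r, c r ∂_), ← integral_prod_mul]
  simpa [polarLaw] using integral_fun_snd (μ := gaussianReal 0 v)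
    (ν := (sphereUniform N).prod (radialLaw (N - 1) v)) fun q => b q.1 * c q.2

lemma integrable_polarConfig_pow (hN : 2 ≤ N) (hv : v ≠ 0) (m : ℝ) (i : Fin N) (k : ℕ) :
    Integrable (fun p => polarConfig N m p i ^ (2 * k)) (polarLaw N v) := by
  have h := integrable_pow_gaussianReal m v k
  rw [← gaussianConfig_map_eval N m v i, gaussianConfig_eq_map_polarConfig N hN m hv,
    Measure.map_map (by fun_prop) (continuous_polarConfig N m).measurable] at h
  exact h.comp_measurable
    (Measurable.comp (by fun_prop) (continuous_polarConfig N m).measurable)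

lemma integral_polarConfig_pow (hN : 2 ≤ N) (hv : v ≠ 0) (m : ℝ) (i : Fin N) (k : ℕ) :
    ∫ p, polarConfig N m p i ^ (2 * k) ∂polarLaw N v =
      ∫ x, x ^ (2 * k) ∂gaussianReal m v := by
  have hm : Measurable fun p => polarConfig N m p i :=
    Measurable.comp (g := fun φ : Config N => φ i) (by fun_prop)
      (continuous_polarConfig N m).measurable
  have h : gaussianReal m v = (polarLaw N v).map fun p => polarConfig N m p i := by
    rw [← gaussianConfig_map_eval N m v i, gaussianConfig_eq_map_polarConfig N hN m hv,
      Measure.map_map (by fun_prop) (continuous_polarConfig N m).measurable]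
    rfl
  rw [h, integral_map hm.aemeasurable (by fun_prop)]

end Moments

/-! ### Uniform moment bounds and the coupling distance. -/

lemma sub_pow_two_mul_le (a b : ℝ) (k : ℕ) :
    (a - b) ^ (2 * k) ≤ 4 ^ k * (a ^ (2 * k) + b ^ (2 * k)) := by
  have h1 : (a - b) ^ 2 ≤ 2 * (a ^ 2 + b ^ 2) := by nlinarith [sq_nonneg (a + b)]
  have h3 : (2 : ℝ) ^ (k - 1) ≤ 2 ^ k := pow_le_pow_right₀ (by norm_num) (by omega)
  have h4 : (4 : ℝ) = 2 * 2 := by norm_num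
  calc (a - b) ^ (2 * k) = ((a - b) ^ 2) ^ k := pow_mul _ _ _
    _ ≤ (2 * (a ^ 2 + b ^ 2)) ^ k := by gcongr
    _ = 2 ^ k * (a ^ 2 + b ^ 2) ^ k := mul_pow _ _ _
    _ ≤ 2 ^ k * (2 ^ (k - 1) * ((a ^ 2) ^ k + (b ^ 2) ^ k)) := by
      gcongr
      exact add_pow_le (sq_nonneg _) (sq_nonneg _) k
    _ ≤ 2 ^ k * (2 ^ k * ((a ^ 2) ^ k + (b ^ 2) ^ k)) := by gcongr
    _ = _ := by rw [h4, mul_pow, pow_mul, pow_mul]; ring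

/-- The even moments of a coordinate of a uniform point of the sphere are of the order of the
inverse powers of the dimension. -/
lemma exists_transversal_moment_le (k : ℕ) :
    ∃ C : ℝ, 0 ≤ C ∧ ∀ (N : ℕ) [NeZero N], 2 ≤ N → ∀ i : Fin N,
      (N : ℝ) ^ k * ∫ ω, transversal N ω.1 i ^ (2 * k) ∂sphereUniform N ≤ C := by
  -- The claim does not involve `v`, so any nonzero variance may serve as the auxiliary Gaussian.
  set v : ℝ≥0 := 1
  have hv : v ≠ 0 := one_ne_zero
  set M : ℝ := ∫ x, x ^ (2 * k) ∂gaussianReal 0 v with hM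
  have hM0 : 0 ≤ M := integral_nonneg fun x => (even_two_mul k).pow_nonneg x
  refine ⟨2 ^ k * (4 ^ k * (M + M)), by positivity, fun N _ hN i => ?_⟩
  have := isProbabilityMeasure_radialLaw hN hv
  have hN1 : 1 ≤ N - 1 := by omega
  set T : ℝ := ∫ ω, transversal N ω.1 i ^ (2 * k) ∂sphereUniform N with hT
  have hT0 : 0 ≤ T := integral_nonneg fun ω => (even_two_mul k).pow_nonneg _
  have hz := integrable_fst_polarLaw (N := N) hN hv (integrable_pow_gaussianReal 0 v k)
  have hY := integrable_polarConfig_pow (N := N) hN hv 0 i k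
  have hpt (p : ℝ × UnitSphere N × ℝ) :
      p.2.2 ^ (2 * k) * transversal N p.2.1.1 i ^ (2 * k) ≤
        4 ^ k * (polarConfig N 0 p i ^ (2 * k) + p.1 ^ (2 * k)) := by
    -- `r τ_i` is a Gaussian coordinate minus `z / √N`, so its moments are bounded independently of
    -- `N`.
    have h1 : p.2.2 * transversal N p.2.1.1 i = polarConfig N 0 p i - p.1 / √(N : ℝ) := by
      rw [polarConfig_apply]
      ring
    rw [← mul_pow, h1]
    refine (sub_pow_two_mul_le _ _ k).trans ?_
    have h2 : (p.1 / √(N : ℝ)) ^ (2 * k) ≤ p.1 ^ (2 * k) := by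
      rw [div_pow]
      refine div_le_self ((even_two_mul k).pow_nonneg _) (one_le_pow₀ ?_)
      rw [Real.one_le_sqrt]
      exact_mod_cast (by omega : 1 ≤ N)
    gcongr
  -- Independence factors the moment of `r τ_i`; the radial factor is at least `((N - 1) v)^k`,
  -- which forces the moment of `τ_i` to be small.
  have hle : (((N - 1 : ℕ) : ℝ) * v) ^ k * T ≤ 4 ^ k * (M + M) := by
    calc (((N - 1 : ℕ) : ℝ) * v) ^ k * T
        ≤ (∫ r, r ^ (2 * k) ∂radialLaw (N - 1) v) * T := by
          gcongr
          exact pow_le_integral_pow_radialLaw hN1 hv k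
      _ = ∫ p, p.2.2 ^ (2 * k) * transversal N p.2.1.1 i ^ (2 * k) ∂polarLaw N v :=
          (integral_snd_polarLaw hN hv (fun ω => transversal N ω.1 i ^ (2 * k))
            fun r => r ^ (2 * k)).symm
      _ ≤ ∫ p, 4 ^ k * (polarConfig N 0 p i ^ (2 * k) + p.1 ^ (2 * k)) ∂polarLaw N v :=
          integral_mono (integrable_snd_polarLaw hN hv (integrable_transversal_pow hN i _)
            (integrable_pow_radialLaw hN1 hv k)) ((hY.add hz).const_mul _) hpt
      _ = 4 ^ k * (M + M) := by
          rw [integral_const_mul, integral_add hY hz, integral_polarConfig_pow hN hv,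
            integral_fst_polarLaw hN hv fun z => z ^ (2 * k)]
  -- Passing from `N - 1` to `N` costs the factor `2 ^ k`.
  have hN2 : (N : ℝ) ≤ 2 * (((N - 1 : ℕ) : ℝ) * v) := by
    have : (N : ℝ) ≤ ((2 * (N - 1) : ℕ) : ℝ) := by exact_mod_cast (by omega)
    simpa [v] using this
  calc (N : ℝ) ^ k * T ≤ (2 * (((N - 1 : ℕ) : ℝ) * v)) ^ k * T := by gcongr
    _ = 2 ^ k * ((((N - 1 : ℕ) : ℝ) * v) ^ k * T) := by rw [mul_pow]; ring
    _ ≤ _ := by gcongr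

lemma integrable_sphereConfig_pow {N : ℕ} [NeZero N] {v : ℝ≥0} (hN : 2 ≤ N) (hv : v ≠ 0)
    (m s : ℝ) (i : Fin N) (k : ℕ) :
    Integrable (fun p => sphereConfig N m s p i ^ k) (polarLaw N v) := by
  have := isProbabilityMeasure_polarLaw (N := N) hN hv
  have hm : Measurable fun p => sphereConfig N m s p i ^ k :=
    Measurable.comp (g := fun φ : Config N => φ i ^ k) (by fun_prop)
      (continuous_sphereConfig N m s).measurable
  refine Integrable.of_bound hm.aestronglyMeasurable ((|m| + |s|) ^ k)
    (Filter.Eventually.of_forall fun p => ?_)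
  rw [norm_pow, Real.norm_eq_abs, sphereConfig_apply]
  gcongr
  refine (abs_add_le _ _).trans ?_
  rw [abs_mul]
  gcongr
  exact mul_le_of_le_one_right (abs_nonneg _) (abs_transversal_le N _ i)

/-- The radius contributes `(N v)^k`, which the `N^{-k}` decay of the transversal moments
compensates. -/
lemma exists_sphereConfig_moment_le (m : ℝ) {v : ℝ≥0} (hv : v ≠ 0) (k : ℕ) :
    ∃ C : ℝ, ∀ (N : ℕ) [NeZero N], 2 ≤ N → ∀ i : Fin N,
      ∫ p, sphereConfig N m (√(N * v)) p i ^ (2 * k) ∂polarLaw N v ≤ C := by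
  obtain ⟨C, hC, h⟩ := exists_transversal_moment_le k
  refine ⟨4 ^ k * ((-m) ^ (2 * k) + v ^ k * C), fun N _ hN i => ?_⟩
  have := isProbabilityMeasure_polarLaw (N := N) hN hv
  have hP := isProbabilityMeasure_radialLaw hN hv
  have hτ : Integrable (fun p => (√(N * v)) ^ (2 * k) * transversal N p.2.1.1 i ^ (2 * k))
      (polarLaw N v) :=
    integrable_snd_polarLaw hN hv (integrable_transversal_pow hN i _) (integrable_const _)
  calc ∫ p, sphereConfig N m (√(N * v)) p i ^ (2 * k) ∂polarLaw N v
      ≤ ∫ p, 4 ^ k * ((√(N * v)) ^ (2 * k) * transversal N p.2.1.1 i ^ (2 * k) +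
          (-m) ^ (2 * k)) ∂polarLaw N v := by
        refine integral_mono (integrable_sphereConfig_pow hN hv _ _ _ _)
          ((hτ.add (integrable_const _)).const_mul _) fun p => ?_
        have := sub_pow_two_mul_le (√(N * v) * transversal N p.2.1.1 i) (-m) k
        rw [mul_pow] at this
        rw [sphereConfig_apply]
        convert! this using 2
        ring
    _ = 4 ^ k * ((-m) ^ (2 * k) + v ^ k * ((N : ℝ) ^ k *
          ∫ ω, transversal N ω.1 i ^ (2 * k) ∂sphereUniform N)) := by
        rw [integral_const_mul, integral_add hτ (integrable_const _),
          integral_snd_polarLaw hN hv (fun ω => transversal N ω.1 i ^ (2 * k))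
            fun _ => (√(N * v)) ^ (2 * k), pow_mul, Real.sq_sqrt (by positivity)]
        simp only [integral_const, probReal_univ, one_smul, mul_pow]
        ring
    _ ≤ _ := by
        gcongr
        exact h N hN i

lemma sq_sphereConfig_sub_polarConfig_le (N : ℕ) [NeZero N] (m s : ℝ)
    (p : ℝ × UnitSphere N × ℝ) (i : Fin N) :
    (sphereConfig N m s p i - polarConfig N m p i) ^ 2 ≤
      2 * ((s - p.2.2) ^ 2 * transversal N p.2.1.1 i ^ 2 + p.1 ^ 2 / N) := by
  have h : p.1 ^ 2 / N = (p.1 / √(N : ℝ)) ^ 2 := by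
    rw [div_pow, Real.sq_sqrt (by positivity)]
  rw [h, sphereConfig_apply, polarConfig_apply, ← mul_pow]
  nlinarith [sq_nonneg ((s - p.2.2) * transversal N p.2.1.1 i + p.1 / √(N : ℝ))]

/-- Length and direction are independent: the length error has bounded mean square, `τ_i²` has mean
`O(1/N)`, and the magnetization fluctuation adds `z² / N`. -/
lemma exists_sq_sphereConfig_sub_polarConfig_le (m : ℝ) {v : ℝ≥0} (hv : v ≠ 0) :
    ∃ C : ℝ, ∀ (N : ℕ) [NeZero N], 2 ≤ N → ∀ i : Fin N,
      Integrable (fun p => (sphereConfig N m (√(N * v)) p i - polarConfig N m p i) ^ 2)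
        (polarLaw N v) ∧
      ∫ p, (sphereConfig N m (√(N * v)) p i - polarConfig N m p i) ^ 2 ∂polarLaw N v
        ≤ C / N := by
  obtain ⟨C, hC, h⟩ := exists_transversal_moment_le 1
  refine ⟨2 * (2 * v * C + ∫ z, z ^ 2 ∂gaussianReal 0 v), fun N _ hN i => ?_⟩
  have hP := isProbabilityMeasure_radialLaw hN hv
  have hN0 : (0 : ℝ) < N := by exact_mod_cast (by omega : 0 < N)
  have hN1 : 1 ≤ N - 1 := by omega
  have hτ := integrable_snd_polarLaw hN hv (integrable_transversal_pow hN i 2)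
    (integrable_sq_sub_radialLaw hN1 hv √(N * v))
  have hz2 : Integrable (fun z : ℝ => z ^ 2) (gaussianReal 0 v) := by
    simpa using integrable_pow_gaussianReal 0 v 1
  have hz : Integrable (fun p : ℝ × UnitSphere N × ℝ => p.1 ^ 2 / N) (polarLaw N v) :=
    integrable_fst_polarLaw hN hv (hz2.div_const _)
  have hb := (hτ.add hz).const_mul 2
  have hm : Measurable fun p =>
      (sphereConfig N m (√(N * v)) p i - polarConfig N m p i) ^ 2 :=
    Measurable.comp (g := fun φ : Config N × Config N => (φ.1 i - φ.2 i) ^ 2) (by fun_prop)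
      ((continuous_sphereConfig N m _).measurable.prodMk (continuous_polarConfig N m).measurable)
  have hint : Integrable
      (fun p => (sphereConfig N m (√(N * v)) p i - polarConfig N m p i) ^ 2) (polarLaw N v) := by
    refine hb.mono' hm.aestronglyMeasurable (Filter.Eventually.of_forall fun p => ?_)
    rw [Real.norm_of_nonneg (sq_nonneg _)]
    exact sq_sphereConfig_sub_polarConfig_le N m _ p i
  refine ⟨hint, ?_⟩
  have hτle : ∫ ω, transversal N ω.1 i ^ 2 ∂sphereUniform N ≤ C / N := by
    rw [le_div_iff₀' hN0]
    simpa using h N hN i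
  have hr : ∫ r, (√(N * v) - r) ^ 2 ∂radialLaw (N - 1) v ≤ 2 * v := by
    have := integral_sq_sub_radialLaw_le hN1 hv
    rwa [Nat.cast_sub (by omega), Nat.cast_one, sub_add_cancel] at this
  calc _ ≤ ∫ p, 2 * ((√(N * v) - p.2.2) ^ 2 * transversal N p.2.1.1 i ^ 2 + p.1 ^ 2 / N)
          ∂polarLaw N v :=
        integral_mono hint hb fun p => sq_sphereConfig_sub_polarConfig_le N m _ p i
    _ = 2 * ((∫ r, (√(N * v) - r) ^ 2 ∂radialLaw (N - 1) v) *
          (∫ ω, transversal N ω.1 i ^ 2 ∂sphereUniform N) +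
          (∫ z, z ^ 2 ∂gaussianReal 0 v) / N) := by
        rw [integral_const_mul, integral_add hτ hz,
          integral_snd_polarLaw hN hv (fun ω => transversal N ω.1 i ^ 2)
            fun r => (√(N * v) - r) ^ 2,
          integral_fst_polarLaw hN hv fun z => z ^ 2 / (N : ℝ), integral_div]
    _ ≤ 2 * (2 * v * (C / N) + (∫ z, z ^ 2 ∂gaussianReal 0 v) / N) := by
        gcongr
    _ = _ := by ring

/-! ### Comparison at fixed magnetization. -/

lemma HasPolynomialGrowth.integrable_comp {n : ℕ} {f : EuclideanSpace ℝ (Fin n) → ℝ}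
    (hf : HasPolynomialGrowth f) (hc : Continuous f) {Ω : Type*} [MeasurableSpace Ω]
    {P : Measure Ω} [IsFiniteMeasure P] {X : Ω → EuclideanSpace ℝ (Fin n)} (hX : Measurable X)
    (hint : ∀ j k, Integrable (fun p => X p j ^ (2 * k)) P) : Integrable (fun p => f (X p)) P := by
  obtain ⟨A, q, hA, h⟩ := hf.abs_sub_le
  have h2 : Integrable (fun p => ∑ j, (X p j - 0) ^ 2) P := by
    simpa using integrable_finsetSum Finset.univ fun j _ => hint j 1
  have hq : Integrable (fun p => ∑ j, X p j ^ (2 * q)) P :=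
    integrable_finsetSum Finset.univ fun j _ => hint j q
  have hb := ((((h2.const_mul 1).add ((((integrable_const 1).add hq).add (integrable_const
    (∑ j : Fin n, (0 : EuclideanSpace ℝ (Fin n)) j ^ (2 * q)))).const_mul 1⁻¹)).const_mul A).add
    (integrable_const |f 0|))
  refine hb.mono' (hc.measurable.comp hX).aestronglyMeasurable
    (Filter.Eventually.of_forall fun p => ?_)
  -- Comparing with the value at the origin, with `t = 1`, dominates `f` by even moments.
  have h1 := h 1 one_pos (X p) 0
  have h3 : |f (X p)| ≤ |f (X p) - f 0| + |f 0| := by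
    simpa using abs_add_le (f (X p) - f 0) (f 0)
  exact h3.trans (add_le_add_left h1 _)

lemma measurable_proj {N n : ℕ} (I : Finset (Fin N)) (hI : I.card = n) :
    Measurable (proj I hI) := by
  have : Continuous (proj I hI) := by unfold proj; fun_prop
  exact this.measurable

/-- Equivalence of the microcanonical ensemble with fixed magnetization and the Gaussian
ensemble. -/
lemma exists_mcMag_sub_gaussianConfig_le {n : ℕ} {f : EuclideanSpace ℝ (Fin n) → ℝ}
    (hf : HasPolynomialGrowth f) (hc : Continuous f) (m ρ : ℝ) {v : ℝ≥0} (hv : v ≠ 0)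
    (hρ : ρ - m ^ 2 = v) :
    ∃ C : ℝ, ∀ (N : ℕ) [NeZero N], 2 ≤ N → ∀ (I : Finset (Fin N)) (hI : I.card = n),
      Integrable (fun φ => f (proj I hI φ)) (mcMag N m ρ) ∧
      Integrable (fun φ => f (proj I hI φ)) (gaussianConfig N m v) ∧
      |(∫ φ, f (proj I hI φ) ∂mcMag N m ρ) - ∫ φ, f (proj I hI φ) ∂gaussianConfig N m v|
        ≤ C * (√(N : ℝ))⁻¹ := by
  obtain ⟨A, q, hA, h⟩ := hf.abs_sub_le
  obtain ⟨C₁, h₁⟩ := exists_sq_sphereConfig_sub_polarConfig_le m hv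
  obtain ⟨C₂, h₂⟩ := exists_sphereConfig_moment_le m hv q
  set C₃ := ∫ x, x ^ (2 * q) ∂gaussianReal m v
  refine ⟨A * (n * C₁ + (1 + n * C₂ + n * C₃)), fun N _ hN I hI => ?_⟩
  have := isProbabilityMeasure_polarLaw (N := N) hN hv
  set s := √((N : ℝ) * v)
  set e : Fin n → Fin N := fun j => I.orderEmbOfFin hI j
  have hS := (continuous_sphereConfig N m s).measurable
  have hP := (continuous_polarConfig N m).measurable
  have hfm : Measurable fun φ : Config N => f (proj I hI φ) :=
    hc.measurable.comp (measurable_proj I hI)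
  have hmc : mcMag N m ρ = (polarLaw N v).map (sphereConfig N m s) := by
    rw [mcMag_eq_map_polarLaw N hN m ρ hv, hρ]
    rfl
  have hXj (j : Fin n) (k : ℕ) :=
    integrable_sphereConfig_pow (N := N) hN hv m s (e j) (2 * k)
  have hYj (j : Fin n) (k : ℕ) := integrable_polarConfig_pow (N := N) hN hv m (e j) k
  have hX : Integrable (fun p => f (proj I hI (sphereConfig N m s p))) (polarLaw N v) :=
    hf.integrable_comp hc ((measurable_proj I hI).comp hS) hXj
  have hY : Integrable (fun p => f (proj I hI (polarConfig N m p))) (polarLaw N v) :=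
    hf.integrable_comp hc ((measurable_proj I hI).comp hP) hYj
  rw [hmc, gaussianConfig_eq_map_polarConfig N hN m hv,
    integrable_map_measure hfm.aestronglyMeasurable hS.aemeasurable,
    integrable_map_measure hfm.aestronglyMeasurable hP.aemeasurable,
    integral_map hS.aemeasurable hfm.aestronglyMeasurable,
    integral_map hP.aemeasurable hfm.aestronglyMeasurable]
  refine ⟨hX, hY, ?_⟩
  have hN0 : 0 < √(N : ℝ) := sqrt_natCast_pos N
  have hD : Integrable (fun p => √(N : ℝ) *
      ∑ j, (sphereConfig N m s p (e j) - polarConfig N m p (e j)) ^ 2) (polarLaw N v) :=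
    (integrable_finsetSum _ fun j _ => (h₁ N hN (e j)).1).const_mul _
  have hXs : Integrable (fun p => ∑ j, sphereConfig N m s p (e j) ^ (2 * q)) (polarLaw N v) :=
    integrable_finsetSum _ fun j _ => hXj j q
  have hYs : Integrable (fun p => ∑ j, polarConfig N m p (e j) ^ (2 * q)) (polarLaw N v) :=
    integrable_finsetSum _ fun j _ => hYj j q
  have h1X : Integrable (fun p => 1 + ∑ j, sphereConfig N m s p (e j) ^ (2 * q))
      (polarLaw N v) := (integrable_const 1).add hXs
  have hM : Integrable (fun p => (√(N : ℝ))⁻¹ * (1 + ∑ j, sphereConfig N m s p (e j) ^ (2 * q) +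
      ∑ j, polarConfig N m p (e j) ^ (2 * q))) (polarLaw N v) := (h1X.add hYs).const_mul _
  rw [← integral_sub hX hY]
  calc _ ≤ ∫ p, |f (proj I hI (sphereConfig N m s p)) - f (proj I hI (polarConfig N m p))|
          ∂polarLaw N v := abs_integral_le_integral_abs
    _ ≤ ∫ p, A * (√(N : ℝ) *
            ∑ j, (sphereConfig N m s p (e j) - polarConfig N m p (e j)) ^ 2 +
          (√(N : ℝ))⁻¹ * (1 + ∑ j, sphereConfig N m s p (e j) ^ (2 * q) +
            ∑ j, polarConfig N m p (e j) ^ (2 * q))) ∂polarLaw N v :=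
        -- The choice `t = √N` balances the two terms: `√N · O(1/N)` against `N^{-1/2} · O(1)`.
        integral_mono (hX.sub hY).abs ((hD.add hM).const_mul A) fun p => h _ hN0 _ _
    _ = A * (√(N : ℝ) * ∑ j, ∫ p, (sphereConfig N m s p (e j) - polarConfig N m p (e j)) ^ 2
            ∂polarLaw N v +
          (√(N : ℝ))⁻¹ * (1 + ∑ j, ∫ p, sphereConfig N m s p (e j) ^ (2 * q) ∂polarLaw N v +
            ∑ j, ∫ p, polarConfig N m p (e j) ^ (2 * q) ∂polarLaw N v)) := by
        rw [integral_const_mul, integral_add hD hM, integral_const_mul, integral_const_mul,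
          integral_add h1X hYs, integral_add (integrable_const _) hXs,
          integral_finsetSum _ fun j _ => (h₁ N hN (e j)).1,
          integral_finsetSum _ fun j _ => hXj j q, integral_finsetSum _ fun j _ => hYj j q]
        simp only [integral_const, probReal_univ, one_smul]
        rfl
    _ ≤ A * (√(N : ℝ) * ∑ _j : Fin n, C₁ / N +
          (√(N : ℝ))⁻¹ * (1 + ∑ _j : Fin n, C₂ + ∑ _j : Fin n, C₃)) := by
        gcongr with j _ j _ j _
        · exact (h₁ N hN (e j)).2
        · exact h₂ N hN (e j)
        · exact (integral_polarConfig_pow hN hv m (e j) q).le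
    _ = A * (n * C₁ + (1 + n * C₂ + n * C₃)) * (√(N : ℝ))⁻¹ := by
        have : √(N : ℝ) * (n * (C₁ / N)) = n * C₁ * (√(N : ℝ))⁻¹ := by
          have h : (N : ℝ) = √(N : ℝ) * √(N : ℝ) := (Real.mul_self_sqrt (by positivity)).symm
          rw [h, Real.sqrt_mul_self hN0.le]
          field_simp
        simp only [Finset.sum_const, Finset.card_univ, Fintype.card_fin, nsmul_eq_mul]
        rw [this]
        ring

/-! ### The fixed-energy ensemble without field, and conclusion. -/

lemma half_smul_add_half_smul {α : Type*} [MeasurableSpace α] (μ : Measure α) :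
    ENNReal.ofReal (1 / 2) • μ + ENNReal.ofReal (1 / 2) • μ = μ := by
  rw [← add_smul, ← ENNReal.ofReal_add (by norm_num) (by norm_num)]
  norm_num

/-- Without external field, the fixed-energy ensemble is the even mixture of the ensembles at the
magnetization densities `±√(-2ε/J)`. -/
lemma mcEnergy_zero_field (N : ℕ) [NeZero N] {J ρ ε : ℝ} (hJ : 0 < J) (hρ : 0 < ρ) (hε : ε ≤ 0)
    (hm : -(2 * ε / J) < ρ) :
    mcEnergy N J 0 ε ρ = ENNReal.ofReal (1 / 2) • mcMag N √(-(2 * ε / J)) ρ +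
      ENNReal.ofReal (1 / 2) • mcMag N (-√(-(2 * ε / J))) ρ := by
  have hp : mPlus J 0 ε = √(-(2 * ε / J)) := by simp [mPlus]
  have hq : mMinus J 0 ε = -√(-(2 * ε / J)) := by simp [mMinus]
  have h0 : 0 ≤ -(2 * ε / J) := by
    rw [← neg_div]
    exact div_nonneg (by linarith) hJ.le
  have hsq : √(-(2 * ε / J)) ^ 2 = -(2 * ε / J) := Real.sq_sqrt h0
  rcases hε.lt_or_eq with hlt | rfl
  · have hz : 0 < zMag N √(-(2 * ε / J)) ρ := by
      rw [zMag, hsq]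
      exact Real.rpow_pos_of_pos (by linarith) _
    -- The partition function is even in the magnetization, hence equal weights.
    have hz' : zMag N (-√(-(2 * ε / J))) ρ = zMag N √(-(2 * ε / J)) ρ := by
      rw [zMag, zMag, neg_sq]
    have hhalf : zMag N √(-(2 * ε / J)) ρ /
        (zMag N √(-(2 * ε / J)) ρ + zMag N √(-(2 * ε / J)) ρ) = 1 / 2 := by
      field_simp
      norm_num
    rw [mcEnergy, hp, hq, hz', hhalf, if_pos]
    rw [neg_sq, hsq]
    exact ⟨by simpa using hlt, hm, hm⟩
  -- At `ε = 0` the strict inequality in the first two branches fails and the third applies; both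
  -- magnetizations are `0`, so the two halves recombine.
  · rw [mcEnergy, if_neg (by simp), if_neg (by simp), if_pos (by simpa using hρ)]
    simp [-one_div, half_smul_add_half_smul]

end

end MeanFieldSpherical

theorem mainTheorem12 (J ρ ε : ℝ) (hJ : 0 < J) (hρ : 0 < ρ)
    (hε : ε ∈ Set.Ioc (-(J * ρ / 2)) 0)
    (μbar η : ℝ)
    (hμbar : μbar = √(-(2 * ε / J)) / (ρ - -(2 * ε / J)))
    (hη : η = 1 / (2 * (ρ - -(2 * ε / J)))) :
    (∀ N : ℕ,
      MeanFieldSpherical.agc N μbar η =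
        ENNReal.ofReal (1 / 2) • MeanFieldSpherical.gc N μbar η +
          ENNReal.ofReal (1 / 2) • MeanFieldSpherical.gc N (-μbar) η) ∧
    ∀ (n : ℕ) (f : EuclideanSpace ℝ (Fin n) → ℝ), MeanFieldSpherical.IsLocalObservable f →
      ∃ (C : ℝ) (N₀ : ℕ), ∀ (N : ℕ) [NeZero N], N₀ ≤ N →
        ∀ (I : Finset (Fin N)) (hI : I.card = n),
          Integrable (fun φ => f (MeanFieldSpherical.proj I hI φ))
            (MeanFieldSpherical.mcEnergy N J 0 ε ρ) ∧
          Integrable (fun φ => f (MeanFieldSpherical.proj I hI φ))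
            (MeanFieldSpherical.agc N μbar η) ∧
          |(∫ φ, f (MeanFieldSpherical.proj I hI φ) ∂(MeanFieldSpherical.mcEnergy N J 0 ε ρ)) -
            ∫ φ, f (MeanFieldSpherical.proj I hI φ) ∂(MeanFieldSpherical.agc N μbar η)|
            ≤ C * (N : ℝ) ^ (-(1 / 2) : ℝ) := by
  obtain ⟨hε₁, hε₂⟩ := hε
  have hm : -(2 * ε / J) < ρ := by
    rw [← neg_div, div_lt_iff₀ hJ]
    linarith
  have h0 : 0 ≤ -(2 * ε / J) := by
    rw [← neg_div]
    exact div_nonneg (by linarith) hJ.le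
  set m := √(-(2 * ε / J)) with hmdef
  have hsq : m ^ 2 = -(2 * ε / J) := Real.sq_sqrt h0
  obtain ⟨v, hv⟩ : ∃ v : NNReal, (v : ℝ) = ρ - -(2 * ε / J) :=
    ⟨⟨ρ - -(2 * ε / J), by linarith⟩, rfl⟩
  have hv0 : v ≠ 0 := by
    rintro rfl
    rw [NNReal.coe_zero] at hv
    linarith
  rw [← hv] at hμbar hη
  subst hμbar hη
  refine ⟨fun N => ?_, fun n f hf => ?_⟩
  -- Positive `μbar` corresponds to mean `-m`, so the two halves appear in the opposite order.
  · rw [MeanFieldSpherical.agc_eq_gaussianConfig N m hv0, MeanFieldSpherical.gc_eq_gaussianConfig N m hv0, ← neg_div,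
      MeanFieldSpherical.gc_eq_gaussianConfig N (-m) hv0, neg_neg, add_comm]
  obtain ⟨C₁, h₁⟩ := MeanFieldSpherical.exists_mcMag_sub_gaussianConfig_le hf.hasPolynomialGrowth hf.continuous m ρ hv0
    (by rw [hsq, hv])
  obtain ⟨C₂, h₂⟩ := MeanFieldSpherical.exists_mcMag_sub_gaussianConfig_le hf.hasPolynomialGrowth hf.continuous (-m) ρ
    hv0 (by rw [neg_sq, hsq, hv])
  -- The two signs are compared separately and averaged; `N₀ = 2` is where the sphere becomes
  -- nonempty.
  refine ⟨1 / 2 * (C₁ + C₂), 2, fun N _ hN I hI => ?_⟩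
  obtain ⟨a₁, b₁, c₁⟩ := h₁ N hN I hI
  obtain ⟨a₂, b₂, c₂⟩ := h₂ N hN I hI
  have ha₁ := a₁.smul_measure (ENNReal.ofReal_ne_top (r := 1 / 2))
  have ha₂ := a₂.smul_measure (ENNReal.ofReal_ne_top (r := 1 / 2))
  have hb₁ := b₁.smul_measure (ENNReal.ofReal_ne_top (r := 1 / 2))
  have hb₂ := b₂.smul_measure (ENNReal.ofReal_ne_top (r := 1 / 2))
  rw [MeanFieldSpherical.mcEnergy_zero_field N hJ hρ hε₂ hm, MeanFieldSpherical.agc_eq_gaussianConfig N m hv0]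
  refine ⟨ha₁.add_measure ha₂, hb₁.add_measure hb₂, ?_⟩
  rw [integral_add_measure ha₁ ha₂, integral_add_measure hb₁ hb₂]
  simp only [integral_smul_measure, smul_eq_mul]
  rw [ENNReal.toReal_ofReal (by norm_num), Real.rpow_neg (by positivity), ← Real.sqrt_eq_rpow]
  rw [abs_le] at c₁ c₂ ⊢
  constructor <;> linarith [c₁.1, c₁.2, c₂.1, c₂.2]
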